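/- Let $F$ be a field of characteristic different from $2$ and $3$. **Definitions.** A *structurable algebra* over $F$ is a unital (not necessarily commutative or associative) $F$-algebra $\mathcal A$ with an $F$-linear involution $x\mapsto\overline x$ such that, with $V_{x,y}(z)=(x\overline y)z+(z\overline y)x-(z\overline x)y$, one has $[V_{x,y},V_{z,w}]=V_{V_{x,y}(z),w}-V_{z,V_{y,x}(w)}$ for all $x,y,z,w$. Isomorphisms are linear isomorphisms preserving product and involution. For a map $\sharp$ write $a\times b=(a+b)^\sharp-a^\sharp-b^\sharp$. A *cubic norm structure* $(J,N,\sharp,T,1)$ over a commutative ring $K$ in which $6$ is invertible is a $K$-module $J$ with maps $N\colon J\to K$, $\sharp\colon J\to J$ such that $\times$ is bilinear, a symmetric bilinear form $T\colon J\times J\to K$ and an element $1\in J\setminus\{0\}$ such that, for all $t\in K$, $a,b\in J$: $(ta)^\sharp=t^2a^\sharp$, $N(ta)=t^3N(a)$, $N(a+b)=N(a)+T(b,a^\sharp)+T(a,b^\sharp)+N(b)$, $a^{\sharp\sharp}=N(a)a$, $1^\sharp=1$, $b=T(b,1)1-1\times b$. Put $U_a(b)=T(a,b)a-a^\sharp\times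 b$. The *matrix structurable algebra* of a cubic norm structure over a field $E$ and $\eta\in E^\times$ is the space of matrices $\begin{pmatrix}s_1&j_1\\j_2&s_2\end{pmatrix}$ ($s_i\in E$, $j_i\in J$) with involution exchanging $s_1$ and $s_2$ and product $$\begin{pmatrix}s_1&j_1\\j_2&s_2\end{pmatrix}\begin{pmatrix}s_1'&j_1'\\j_2'&s_2'\end{pmatrix}=\begin{pmatrix}s_1s_1'+\eta T(j_1,j_2')&s_1j_1'+s_2'j_1+\eta\, j_2\times j_2'\\ s_2j_2'+s_1'j_2+j_1\times j_1'&s_2s_2'+\eta T(j_2,j_1')\end{pmatrix}.$$ Let $K/F$ be a quadratic étale extension (an étale $F$-algebra of dimension $2$, possibly split) with non-trivial automorphism $\sigma$. A *hermitian cubic norm structure* $\mathcal K=(J,N,\sharp,T)$ over $K/F$ is a $K$-module $J$ with a non-zero map $N\colon J\to K$, a map $\sharp\colon J\to J$ such that $\times$ is $\sigma$-semilinear in both variables, and a hermitian form $T\colon J\times J\to K$ (biadditive, $T(sa,tb)=st^\sigma T(a,b)$, $T(a,b)^\sigma=T(b,a)$) such that, for all $t\in K$, $a,b\in J$: $(ta)^\sharp=t^{2\sigma}a^\sharp$,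 $N(ta)=t^3N(a)$, $N(a+b)=N(a)+T(b,a^\sharp)+T(a,b^\sharp)+N(b)$, $a^{\sharp\sharp}=N(a)a$. The algebra $\mathcal A(\mathcal K)$ is $K\oplus J$ with $\overline{(s,b)}=(s^\sigma,b)$ and $(s,b)(t,c)=(st+T(b,c),\,sc+t^\sigma b+b\times c)$. A *$\sigma$-semilinear self-adjoint autotopy* of a cubic norm structure $\mathcal J=(J,N,\sharp,T,1)$ over $K$ is a $\sigma$-semilinear bijection $\varphi\colon J\to J$ such that, with $z=\varphi(1)$, $N(z)$ is invertible in $K$, $\varphi(a^\sharp)=N(z)^{-1}U_z(\varphi(a)^\sharp)$ for all $a$, and $\varphi^{-1}U_z=\varphi$. Given moreover $\gamma\in K$ with $\gamma\gamma^\sigma=N(\varphi(1))^{-1}$, the algebra $\mathcal A(\mathcal J,\varphi,\gamma)$ is $K\oplus J$ with $\overline{(s,b)}=(s^\sigma,b)$ and $(s,b)(t,c)=(st+T(b,\varphi(c)),\,sc+t^\sigma b+\gamma\,(\varphi(b)\times\varphi(c)))$. **Theorem.** Let $E/F$ be a field extension of degree $\le 2$ and let $\mathcal A$ be a structurable algebra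 over $F$ such that $\mathcal A\otimes_F E$ (with the $E$-linearly extended involution) is isomorphic, as an $E$-algebra with involution, to a matrix structurable algebra over $E$. Then there is a quadratic étale extension $K/F$ with non-trivial automorphism $\sigma$ such that: 1. there are a hermitian cubic norm structure $\mathcal K$ over $K/F$ and an isomorphism $\mathcal A(\mathcal K)\cong\mathcal A$ of algebras with involution that maps $K\oplus 0$ onto the $F$-subalgebra of $\mathcal A$ generated by the skew elements $\{x\mid\overline x=-x\}$; 2. there are a cubic norm structure $\mathcal J$ over $K$, a $\sigma$-semilinear self-adjoint autotopy $\varphi$ of $\mathcal J$, an element $\gamma\in K$ with $\gamma\gamma^\sigma=N(\varphi(1))^{-1}$, and an isomorphism $\mathcal A(\mathcal J,\varphi,\gamma)\cong\mathcal A$ of algebras with involution that maps $K\oplus 0$ onto the $F$-subalgebra of $\mathcal A$ generated by the skew elements. -/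

import Mathlib

open scoped TensorProduct

universe u v w x

/-! ### Structurable algebras -/

section Structurable

variable {F : Type u} [CommRing F] {A : Type v} [NonAssocRing A] [Module F A]

/-- The operators `V_{x,y}(z) = (x ȳ) z + (z ȳ) x - (z x̄) y`, where `ι x = x̄`. -/
def structurableV (ι : A →ₗ[F] A) (x y z : A) : A :=
  (x * ι y) * z + (z * ι y) * x - (z * ι x) * y

/-- A unital (not necessarily commutative or associative) algebra `A` with `F`-linear involution `ι`
is structurable if `[V_{x,y}, V_{z,w}] = V_{V_{x,y}(z),w} - V_{z,V_{y,x}(w)}`. -/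
structure IsStructurable (ι : A →ₗ[F] A) : Prop where
  invol : ∀ x, ι (ι x) = x
  map_mul : ∀ x y, ι (x * y) = ι y * ι x
  structurable : ∀ x y z w a,
    structurableV ι x y (structurableV ι z w a) - structurableV ι z w (structurableV ι x y a) =
      structurableV ι (structurableV ι x y z) w a - structurableV ι z (structurableV ι y x w) a

end Structurable

/-- Isomorphisms of `F`-algebras with involution. -/
structure InvolutionAlgEquiv (F : Type u) [CommRing F]
    {A : Type v} [NonAssocRing A] [Module F A] (ιA : A →ₗ[F] A)
    {B : Type w} [NonAssocRing B] [Module F B] (ιB : B →ₗ[F] B) extends A ≃ₗ[F] B where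
  map_mul : ∀ x y, toFun (x * y) = toFun x * toFun y
  map_inv : ∀ x, toFun (ιA x) = ιB (toFun x)

/-! ### Cubic norm structures -/

/-- A cubic norm structure on the `K`-module `J` (for `K` in which `6` is invertible). The map
`a × b = (a + b)^♯ - a^♯ - b^♯` is `QuadraticMap.polar sharp a b`; it is required to be bilinear,
i.e. `♯` is a quadratic map. -/
structure CubicNormStructure (K : Type u) [CommRing K] (J : Type v) [AddCommGroup J]
    [Module K J] where
  norm : J → K
  sharp : J → J
  trace : J →ₗ[K] J →ₗ[K] K
  one : J
  trace_symm : ∀ a b, trace a b = trace b a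
  one_ne_zero : one ≠ 0
  cross_add_left : ∀ a b c, QuadraticMap.polar sharp (a + b) c =
    QuadraticMap.polar sharp a c + QuadraticMap.polar sharp b c
  cross_smul_left : ∀ (t : K) (a b : J), QuadraticMap.polar sharp (t • a) b =
    t • QuadraticMap.polar sharp a b
  sharp_smul : ∀ (t : K) (a : J), sharp (t • a) = t ^ 2 • sharp a
  norm_smul : ∀ (t : K) (a : J), norm (t • a) = t ^ 3 * norm a
  norm_add : ∀ a b, norm (a + b) = norm a + trace b (sharp a) + trace a (sharp b) + norm b
  sharp_sharp : ∀ a, sharp (sharp a) = norm a • a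
  sharp_one : sharp one = one
  eq_sub_cross_one : ∀ b, b = trace b one • one - QuadraticMap.polar sharp one b

namespace CubicNormStructure

variable {K : Type u} [CommRing K] {J : Type v} [AddCommGroup J] [Module K J]
  (𝒥 : CubicNormStructure K J)

/-- `a × b = (a + b)^♯ - a^♯ - b^♯` -/
def cross (a b : J) : J := QuadraticMap.polar 𝒥.sharp a b

/-- `U_a(b) = T(a, b) a - a^♯ × b` -/
def U (a b : J) : J := 𝒥.trace a b • a - 𝒥.cross (𝒥.sharp a) b

theorem cross_add_l (a b c : J) : 𝒥.cross (a + b) c = 𝒥.cross a c + 𝒥.cross b c :=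
  𝒥.cross_add_left a b c

theorem cross_symm (a b : J) : 𝒥.cross a b = 𝒥.cross b a :=
  QuadraticMap.polar_comm _ a b

theorem cross_add_r (a b c : J) : 𝒥.cross a (b + c) = 𝒥.cross a b + 𝒥.cross a c := by
  rw [𝒥.cross_symm a, 𝒥.cross_symm a, 𝒥.cross_symm a, cross_add_l]

theorem cross_zero_l (a : J) : 𝒥.cross 0 a = 0 := by
  have h := 𝒥.cross_add_l 0 0 a
  simpa using h

theorem cross_zero_r (a : J) : 𝒥.cross a 0 = 0 := by
  rw [cross_symm, cross_zero_l]

end CubicNormStructure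

/-! ### Matrix structurable algebras -/

section Matrix

variable {F : Type u} [CommRing F] {J : Type v} [AddCommGroup J] [Module F J]

/-- The underlying space of the matrix algebra: `(s₁, j₁, j₂, s₂)` stands for the `2 × 2` matrix
with first row `s₁, j₁` and second row `j₂, s₂`. -/
@[nolint unusedArguments]
def MatrixStructurable (_𝒥 : CubicNormStructure F J) (_η : F) : Type (max u v) := F × J × J × F

namespace MatrixStructurable

variable (𝒥 : CubicNormStructure F J) (η : F)

instance : AddCommGroup (MatrixStructurable 𝒥 η) := inferInstanceAs (AddCommGroup (F × J × J × F))

instance : Mul (MatrixStructurable 𝒥 η) where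
  mul x y :=
    match x, y with
    | (s₁, j₁, j₂, s₂), (t₁, k₁, k₂, t₂) =>
      (s₁ * t₁ + η * 𝒥.trace j₁ k₂,
       s₁ • k₁ + t₂ • j₁ + η • 𝒥.cross j₂ k₂,
       s₂ • k₂ + t₁ • j₂ + 𝒥.cross j₁ k₁,
       s₂ * t₂ + η * 𝒥.trace j₂ k₁)

instance : One (MatrixStructurable 𝒥 η) := ⟨((1, 0, 0, 1) : F × J × J × F)⟩

instance : NonAssocRing (MatrixStructurable 𝒥 η) where
  __ := (inferInstance : AddCommGroup (MatrixStructurable 𝒥 η))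
  __ := (inferInstance : Mul (MatrixStructurable 𝒥 η))
  __ := (inferInstance : One (MatrixStructurable 𝒥 η))
  left_distrib := by
    rintro ⟨s₁, j₁, j₂, s₂⟩ ⟨t₁, k₁, k₂, t₂⟩ ⟨r₁, l₁, l₂, r₂⟩
    refine Prod.ext ?_ (Prod.ext ?_ (Prod.ext ?_ ?_))
    · change s₁ * (t₁ + r₁) + η * 𝒥.trace j₁ (k₂ + l₂) =
        (s₁ * t₁ + η * 𝒥.trace j₁ k₂) + (s₁ * r₁ + η * 𝒥.trace j₁ l₂)
      rw [map_add]; ring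
    · change s₁ • (k₁ + l₁) + (t₂ + r₂) • j₁ + η • 𝒥.cross j₂ (k₂ + l₂) =
        (s₁ • k₁ + t₂ • j₁ + η • 𝒥.cross j₂ k₂) + (s₁ • l₁ + r₂ • j₁ + η • 𝒥.cross j₂ l₂)
      rw [𝒥.cross_add_r]; module
    · change s₂ • (k₂ + l₂) + (t₁ + r₁) • j₂ + 𝒥.cross j₁ (k₁ + l₁) =
        (s₂ • k₂ + t₁ • j₂ + 𝒥.cross j₁ k₁) + (s₂ • l₂ + r₁ • j₂ + 𝒥.cross j₁ l₁)
      rw [𝒥.cross_add_r]; module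
    · change s₂ * (t₂ + r₂) + η * 𝒥.trace j₂ (k₁ + l₁) =
        (s₂ * t₂ + η * 𝒥.trace j₂ k₁) + (s₂ * r₂ + η * 𝒥.trace j₂ l₁)
      rw [map_add]; ring
  right_distrib := by
    rintro ⟨s₁, j₁, j₂, s₂⟩ ⟨t₁, k₁, k₂, t₂⟩ ⟨r₁, l₁, l₂, r₂⟩
    refine Prod.ext ?_ (Prod.ext ?_ (Prod.ext ?_ ?_))
    · change (s₁ + t₁) * r₁ + η * 𝒥.trace (j₁ + k₁) l₂ =
        (s₁ * r₁ + η * 𝒥.trace j₁ l₂) + (t₁ * r₁ + η * 𝒥.trace k₁ l₂)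
      rw [map_add, LinearMap.add_apply]; ring
    · change (s₁ + t₁) • l₁ + r₂ • (j₁ + k₁) + η • 𝒥.cross (j₂ + k₂) l₂ =
        (s₁ • l₁ + r₂ • j₁ + η • 𝒥.cross j₂ l₂) + (t₁ • l₁ + r₂ • k₁ + η • 𝒥.cross k₂ l₂)
      rw [𝒥.cross_add_l]; module
    · change (s₂ + t₂) • l₂ + r₁ • (j₂ + k₂) + 𝒥.cross (j₁ + k₁) l₁ =
        (s₂ • l₂ + r₁ • j₂ + 𝒥.cross j₁ l₁) + (t₂ • l₂ + r₁ • k₂ + 𝒥.cross k₁ l₁)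
      rw [𝒥.cross_add_l]; module
    · change (s₂ + t₂) * r₂ + η * 𝒥.trace (j₂ + k₂) l₁ =
        (s₂ * r₂ + η * 𝒥.trace j₂ l₁) + (t₂ * r₂ + η * 𝒥.trace k₂ l₁)
      rw [map_add, LinearMap.add_apply]; ring
  zero_mul := by
    rintro ⟨s₁, j₁, j₂, s₂⟩
    refine Prod.ext ?_ (Prod.ext ?_ (Prod.ext ?_ ?_))
    · change (0 : F) * s₁ + η * 𝒥.trace 0 j₂ = 0
      simp
    · change (0 : F) • j₁ + s₂ • (0 : J) + η • 𝒥.cross 0 j₂ = 0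
      simp [𝒥.cross_zero_l]
    · change (0 : F) • j₂ + s₁ • (0 : J) + 𝒥.cross 0 j₁ = 0
      simp [𝒥.cross_zero_l]
    · change (0 : F) * s₂ + η * 𝒥.trace 0 j₁ = 0
      simp
  mul_zero := by
    rintro ⟨s₁, j₁, j₂, s₂⟩
    refine Prod.ext ?_ (Prod.ext ?_ (Prod.ext ?_ ?_))
    · change s₁ * (0 : F) + η * 𝒥.trace j₁ 0 = 0
      simp
    · change s₁ • (0 : J) + (0 : F) • j₁ + η • 𝒥.cross j₂ 0 = 0
      simp [𝒥.cross_zero_r]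
    · change s₂ • (0 : J) + (0 : F) • j₂ + 𝒥.cross j₁ 0 = 0
      simp [𝒥.cross_zero_r]
    · change s₂ * (0 : F) + η * 𝒥.trace j₂ 0 = 0
      simp
  one_mul := by
    rintro ⟨s₁, j₁, j₂, s₂⟩
    refine Prod.ext ?_ (Prod.ext ?_ (Prod.ext ?_ ?_))
    · change (1 : F) * s₁ + η * 𝒥.trace 0 j₂ = s₁
      simp
    · change (1 : F) • j₁ + s₂ • (0 : J) + η • 𝒥.cross 0 j₂ = j₁
      simp [𝒥.cross_zero_l]
    · change (1 : F) • j₂ + s₁ • (0 : J) + 𝒥.cross 0 j₁ = j₂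
      simp [𝒥.cross_zero_l]
    · change (1 : F) * s₂ + η * 𝒥.trace 0 j₁ = s₂
      simp
  mul_one := by
    rintro ⟨s₁, j₁, j₂, s₂⟩
    refine Prod.ext ?_ (Prod.ext ?_ (Prod.ext ?_ ?_))
    · change s₁ * (1 : F) + η * 𝒥.trace j₁ 0 = s₁
      simp
    · change s₁ • (0 : J) + (1 : F) • j₁ + η • 𝒥.cross j₂ 0 = j₁
      simp [𝒥.cross_zero_r]
    · change s₂ • (0 : J) + (1 : F) • j₂ + 𝒥.cross j₁ 0 = j₂
      simp [𝒥.cross_zero_r]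
    · change s₂ * (1 : F) + η * 𝒥.trace j₂ 0 = s₂
      simp

instance : Module F (MatrixStructurable 𝒥 η) := inferInstanceAs (Module F (F × J × J × F))

/-- The involution exchanging the two diagonal entries. -/
def involution : MatrixStructurable 𝒥 η →ₗ[F] MatrixStructurable 𝒥 η where
  toFun x :=
    match x with
    | (s₁, j₁, j₂, s₂) => (s₂, j₁, j₂, s₁)
  map_add' _ _ := rfl
  map_smul' _ _ := rfl

end MatrixStructurable

end Matrix

/-! ### Hermitian cubic norm structures -/

/-- `K/F` is a quadratic étale extension. -/
def IsQuadraticEtale (F : Type u) (K : Type v) [Field F] [CommRing K] [Algebra F K] : Prop :=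
  Algebra.Etale F K ∧ Module.finrank F K = 2

section Hermitian

variable {F : Type u} [Field F] {K : Type v} [CommRing K] [Algebra F K]

/-- A hermitian (non-unital) cubic norm structure on the `K`-module `J`, where `σ` is the non-trivial
automorphism of the quadratic étale extension `K/F`. The map `a × b = (a + b)^♯ - a^♯ - b^♯` is
`QuadraticMap.polar sharp a b`; it is required to be `σ`-semilinear in both variables. -/
structure HermitianCubicNormStructure (σ : K ≃ₐ[F] K) (J : Type w) [AddCommGroup J]
    [Module K J] where
  norm : J → K
  sharp : J → J
  trace : J → J → K
  norm_ne_zero : norm ≠ 0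
  trace_add_left : ∀ a b c, trace (a + b) c = trace a c + trace b c
  trace_smul : ∀ (s t : K) (a b : J), trace (s • a) (t • b) = s * σ t * trace a b
  trace_herm : ∀ a b, σ (trace a b) = trace b a
  cross_add_left : ∀ a b c, QuadraticMap.polar sharp (a + b) c =
    QuadraticMap.polar sharp a c + QuadraticMap.polar sharp b c
  cross_smul_left : ∀ (t : K) (a b : J), QuadraticMap.polar sharp (t • a) b =
    σ t • QuadraticMap.polar sharp a b
  sharp_smul : ∀ (t : K) (a : J), sharp (t • a) = σ t ^ 2 • sharp a
  norm_smul : ∀ (t : K) (a : J), norm (t • a) = t ^ 3 * norm a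
  norm_add : ∀ a b, norm (a + b) = norm a + trace b (sharp a) + trace a (sharp b) + norm b
  sharp_sharp : ∀ a, sharp (sharp a) = norm a • a

variable {σ : K ≃ₐ[F] K} {J : Type w} [AddCommGroup J] [Module K J]

namespace HermitianCubicNormStructure

variable (𝒦 : HermitianCubicNormStructure σ J)

/-- `a × b = (a + b)^♯ - a^♯ - b^♯` -/
def cross (a b : J) : J := QuadraticMap.polar 𝒦.sharp a b

theorem cross_add_l (a b c : J) : 𝒦.cross (a + b) c = 𝒦.cross a c + 𝒦.cross b c :=
  𝒦.cross_add_left a b c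

theorem cross_symm (a b : J) : 𝒦.cross a b = 𝒦.cross b a :=
  QuadraticMap.polar_comm _ a b

theorem cross_add_r (a b c : J) : 𝒦.cross a (b + c) = 𝒦.cross a b + 𝒦.cross a c := by
  rw [𝒦.cross_symm a, 𝒦.cross_symm a, 𝒦.cross_symm a, cross_add_l]

theorem cross_zero_l (a : J) : 𝒦.cross 0 a = 0 := by
  have h := 𝒦.cross_add_l 0 0 a
  simpa using h

theorem cross_zero_r (a : J) : 𝒦.cross a 0 = 0 := by
  rw [cross_symm, cross_zero_l]

theorem trace_add_right (a b c : J) : 𝒦.trace a (b + c) = 𝒦.trace a b + 𝒦.trace a c := by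
  rw [← 𝒦.trace_herm, 𝒦.trace_add_left, map_add, 𝒦.trace_herm, 𝒦.trace_herm]

theorem trace_zero_left (a : J) : 𝒦.trace 0 a = 0 := by
  have h := 𝒦.trace_add_left 0 0 a
  simpa using h

theorem trace_zero_right (a : J) : 𝒦.trace a 0 = 0 := by
  rw [← 𝒦.trace_herm, trace_zero_left, map_zero]

/-- The underlying space `K ⊕ J` of the structurable algebra `𝒜(𝒦)`. -/
@[nolint unusedArguments]
def Alg (_𝒦 : HermitianCubicNormStructure σ J) : Type (max v w) := K × J

namespace Alg

instance : AddCommGroup 𝒦.Alg := inferInstanceAs (AddCommGroup (K × J))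

/-- `(s, b)(t, c) = (st + T(b, c), sc + t^σ b + b × c)` -/
instance : Mul 𝒦.Alg where
  mul x y :=
    match x, y with
    | (s, b), (t, c) => (s * t + 𝒦.trace b c, s • c + σ t • b + 𝒦.cross b c)

instance : One 𝒦.Alg := ⟨((1, 0) : K × J)⟩

instance : NonAssocRing 𝒦.Alg where
  __ := (inferInstance : AddCommGroup 𝒦.Alg)
  __ := (inferInstance : Mul 𝒦.Alg)
  __ := (inferInstance : One 𝒦.Alg)
  left_distrib := by
    rintro ⟨s, b⟩ ⟨t, c⟩ ⟨r, d⟩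
    refine Prod.ext ?_ ?_
    · change s * (t + r) + 𝒦.trace b (c + d) = (s * t + 𝒦.trace b c) + (s * r + 𝒦.trace b d)
      rw [𝒦.trace_add_right]; ring
    · change s • (c + d) + σ (t + r) • b + 𝒦.cross b (c + d) =
        (s • c + σ t • b + 𝒦.cross b c) + (s • d + σ r • b + 𝒦.cross b d)
      rw [𝒦.cross_add_r, map_add]; module
  right_distrib := by
    rintro ⟨s, b⟩ ⟨t, c⟩ ⟨r, d⟩
    refine Prod.ext ?_ ?_
    · change (s + t) * r + 𝒦.trace (b + c) d = (s * r + 𝒦.trace b d) + (t * r + 𝒦.trace c d)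
      rw [𝒦.trace_add_left]; ring
    · change (s + t) • d + σ r • (b + c) + 𝒦.cross (b + c) d =
        (s • d + σ r • b + 𝒦.cross b d) + (t • d + σ r • c + 𝒦.cross c d)
      rw [𝒦.cross_add_l]; module
  zero_mul := by
    rintro ⟨s, b⟩
    refine Prod.ext ?_ ?_
    · change 0 * s + 𝒦.trace 0 b = 0
      simp [𝒦.trace_zero_left]
    · change (0 : K) • b + σ s • (0 : J) + 𝒦.cross 0 b = 0
      simp [𝒦.cross_zero_l]
  mul_zero := by
    rintro ⟨s, b⟩
    refine Prod.ext ?_ ?_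
    · change s * 0 + 𝒦.trace b 0 = 0
      simp [𝒦.trace_zero_right]
    · change s • (0 : J) + σ 0 • b + 𝒦.cross b 0 = 0
      simp [𝒦.cross_zero_r]
  one_mul := by
    rintro ⟨s, b⟩
    refine Prod.ext ?_ ?_
    · change 1 * s + 𝒦.trace 0 b = s
      simp [𝒦.trace_zero_left]
    · change (1 : K) • b + σ s • (0 : J) + 𝒦.cross 0 b = b
      simp [𝒦.cross_zero_l]
  mul_one := by
    rintro ⟨s, b⟩
    refine Prod.ext ?_ ?_
    · change s * 1 + 𝒦.trace b 0 = s
      simp [𝒦.trace_zero_right]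
    · change s • (0 : J) + σ 1 • b + 𝒦.cross b 0 = b
      simp [𝒦.cross_zero_r]

instance : Module K 𝒦.Alg := inferInstanceAs (Module K (K × J))

instance : Module F 𝒦.Alg := Module.compHom 𝒦.Alg (algebraMap F K)

/-- The involution `(s, b) ↦ (s^σ, b)`. -/
def involution : 𝒦.Alg →ₗ[F] 𝒦.Alg where
  toFun x :=
    match x with
    | (s, b) => (σ s, b)
  map_add' := by
    rintro ⟨s, b⟩ ⟨t, c⟩
    exact Prod.ext (map_add σ s t) rfl
  map_smul' := by
    rintro r ⟨s, b⟩
    refine Prod.ext ?_ (by rfl)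
    change σ (algebraMap F K r * s) = algebraMap F K r * σ s
    rw [map_mul, AlgEquiv.commutes]

/-- The element `(s, 0)` of `𝒜(𝒦)`. -/
def ofScalar (s : K) : 𝒦.Alg := ((s, 0) : K × J)

end Alg

end HermitianCubicNormStructure

end Hermitian

/-! ### The construction from semilinear self-adjoint autotopies -/

section Autotopy

variable {F : Type u} [Field F] {K : Type v} [CommRing K] [Algebra F K]

/-- A cubic norm structure `𝒥` over `K` together with a `σ`-semilinear self-adjoint autotopy `φ`
of `𝒥` and an element `γ ∈ K` with `γ^{σ+1} = N(φ(1))⁻¹`.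
With `z = φ(1)`, which is invertible, being an autotopy means `φ(a^♯) = N(z)⁻¹ U_z(φ(a)^♯)`;
the adjoint of `φ` is `φ⁻¹ U_z`. -/
structure SelfAdjointAutotopy (σ : K ≃ₐ[F] K) (J : Type w) [AddCommGroup J] [Module K J]
    extends CubicNormStructure K J where
  φ : J ≃+ J
  φ_smul : ∀ (t : K) (a : J), φ (t • a) = σ t • φ a
  isUnit_norm_φ_one : IsUnit (norm (φ one))
  φ_sharp : ∀ a, φ (sharp a) =
    Ring.inverse (norm (φ one)) • toCubicNormStructure.U (φ one) (sharp (φ a))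
  selfAdjoint : ∀ a, φ.symm (toCubicNormStructure.U (φ one) a) = φ a
  γ : K
  γ_mul : γ * σ γ = Ring.inverse (norm (φ one))

variable {σ : K ≃ₐ[F] K} {J : Type w} [AddCommGroup J] [Module K J]

namespace SelfAdjointAutotopy

variable (P : SelfAdjointAutotopy σ J)

/-- The underlying space `K ⊕ J` of the structurable algebra defined by `P`. -/
@[nolint unusedArguments]
def Alg (_P : SelfAdjointAutotopy σ J) : Type (max v w) := K × J

namespace Alg

instance : AddCommGroup P.Alg := inferInstanceAs (AddCommGroup (K × J))

/-- `(s, b)(t, c) = (st + T(b, φ(c)), sc + t^σ b + γ (φ(b) × φ(c)))` -/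
instance : Mul P.Alg where
  mul x y :=
    match x, y with
    | (s, b), (t, c) =>
      (s * t + P.trace b (P.φ c), s • c + σ t • b + P.γ • P.cross (P.φ b) (P.φ c))

instance : One P.Alg := ⟨((1, 0) : K × J)⟩

instance : NonAssocRing P.Alg where
  __ := (inferInstance : AddCommGroup P.Alg)
  __ := (inferInstance : Mul P.Alg)
  __ := (inferInstance : One P.Alg)
  left_distrib := by
    rintro ⟨s, b⟩ ⟨t, c⟩ ⟨r, d⟩
    refine Prod.ext ?_ ?_
    · change s * (t + r) + P.trace b (P.φ (c + d)) =
        (s * t + P.trace b (P.φ c)) + (s * r + P.trace b (P.φ d))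
      rw [map_add, map_add]; ring
    · change s • (c + d) + σ (t + r) • b + P.γ • P.cross (P.φ b) (P.φ (c + d)) =
        (s • c + σ t • b + P.γ • P.cross (P.φ b) (P.φ c)) +
          (s • d + σ r • b + P.γ • P.cross (P.φ b) (P.φ d))
      rw [map_add σ, map_add P.φ, P.cross_add_r]; module
  right_distrib := by
    rintro ⟨s, b⟩ ⟨t, c⟩ ⟨r, d⟩
    refine Prod.ext ?_ ?_
    · change (s + t) * r + P.trace (b + c) (P.φ d) =
        (s * r + P.trace b (P.φ d)) + (t * r + P.trace c (P.φ d))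
      rw [map_add, LinearMap.add_apply]; ring
    · change (s + t) • d + σ r • (b + c) + P.γ • P.cross (P.φ (b + c)) (P.φ d) =
        (s • d + σ r • b + P.γ • P.cross (P.φ b) (P.φ d)) +
          (t • d + σ r • c + P.γ • P.cross (P.φ c) (P.φ d))
      rw [map_add, P.cross_add_l]; module
  zero_mul := by
    rintro ⟨s, b⟩
    refine Prod.ext ?_ ?_
    · change 0 * s + P.trace 0 (P.φ b) = 0
      simp
    · change (0 : K) • b + σ s • (0 : J) + P.γ • P.cross (P.φ 0) (P.φ b) = 0
      simp [P.cross_zero_l]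
  mul_zero := by
    rintro ⟨s, b⟩
    refine Prod.ext ?_ ?_
    · change s * 0 + P.trace b (P.φ 0) = 0
      simp
    · change s • (0 : J) + σ 0 • b + P.γ • P.cross (P.φ b) (P.φ 0) = 0
      simp [P.cross_zero_r]
  one_mul := by
    rintro ⟨s, b⟩
    refine Prod.ext ?_ ?_
    · change 1 * s + P.trace 0 (P.φ b) = s
      simp
    · change (1 : K) • b + σ s • (0 : J) + P.γ • P.cross (P.φ 0) (P.φ b) = b
      simp [P.cross_zero_l]
  mul_one := by
    rintro ⟨s, b⟩
    refine Prod.ext ?_ ?_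
    · change s * 1 + P.trace b (P.φ 0) = s
      simp
    · change s • (0 : J) + σ 1 • b + P.γ • P.cross (P.φ b) (P.φ 0) = b
      simp [P.cross_zero_r]

instance : Module K P.Alg := inferInstanceAs (Module K (K × J))

instance : Module F P.Alg := Module.compHom P.Alg (algebraMap F K)

/-- The involution `(s, b) ↦ (s^σ, b)`. -/
def involution : P.Alg →ₗ[F] P.Alg where
  toFun x :=
    match x with
    | (s, b) => (σ s, b)
  map_add' := by
    rintro ⟨s, b⟩ ⟨t, c⟩
    exact Prod.ext (map_add σ s t) rfl
  map_smul' := by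
    rintro r ⟨s, b⟩
    refine Prod.ext ?_ (by rfl)
    change σ (algebraMap F K r * s) = algebraMap F K r * σ s
    rw [map_mul, AlgEquiv.commutes]

/-- The element `(s, 0)` of the algebra defined by `P`. -/
def ofScalar (s : K) : P.Alg := ((s, 0) : K × J)

end Alg

end SelfAdjointAutotopy

end Autotopy

/-!
Write `M` for the matrix algebra over `E` and embed `A` in it by `a ↦ 1 ⊗ a`. The skew elements of
`M` are the multiples of `diag(1, -1)`, so those of `A` form a line `F s`, where `s` has matrix
`diag(lam, -lam)` and `s² = μ` is a nonzero element of `F`. Hence the skew elements generate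
`K = F[s]`, a quadratic étale extension with automorphism `σ : s ↦ -s`. The projections of `M` onto
its diagonal and its off-diagonal part are given by multiplications with `s`, so `A = K ⊕ J`, where
`J` consists of the elements of `A` with zero diagonal (`exists_decomp`).

For `b, c ∈ J` write `b c = T(b, c) + b × c` with `T(b, c) ∈ K` and `b × c ∈ J`, and put
`b^♯ = (b × b) / 2` and `N(b) = T(b, b^♯) / 3`. An element of `K` is determined by its two diagonal
entries, which are exchanged by `σ`, and an element of `J` by its two off-diagonal entries. Read off
on these entries, the axioms of a hermitian cubic norm structure become identities of the given
cubic norm structure over `E` (`HermitianCubicNormStructure.exists_of_split`), and the decomposition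
is an isomorphism `𝒜(𝒦) ≅ A` (`algEquiv`).

For the second description, choose `u ∈ J` such that `N(u)` is invertible
(`exists_norm_ne_zero`). The operators `U_a(b) = T(a, b) a - a^♯ × b` are `σ`-semilinear in `b`, and
`U_u` is invertible. Twisting by `U_u⁻¹` makes the hermitian data linear: `J` with base point `u`,
norm `N(u)⁻¹ N`, trace form `T(b, U_u⁻¹ d)` and sharp map `d ↦ N(u) (U_u⁻¹ d)^♯` is a cubic norm
structure over `K` (`isotope`), and `U_u` is a self-adjoint autotopy of it (`autotopy`). With
`γ = N(u)⁻¹` the algebra it defines is `𝒜(𝒦)` again, with the identity map as isomorphism. This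
rests on `U_a U_{a^♯} = N(a)²`, `U_a(b)^♯ = U_{a^♯}(b^♯)` and `U_{U_a(a)} = U_a U_a U_a`, which
follow from the linearizations of `a^♯^♯ = N(a) a` (`sharp_cross`, `cross_sharp_cross`).
-/

/-! ### Identities in hermitian cubic norm structures -/

namespace HermitianCubicNormStructure

section Identities

variable {F : Type u} [Field F] {K : Type v} [CommRing K] [Algebra F K]
  {σ : K ≃ₐ[F] K} {J : Type w} [AddCommGroup J] [Module K J]
  (𝒦 : HermitianCubicNormStructure σ J)

theorem cross_smul_l (t : K) (a b : J) : 𝒦.cross (t • a) b = σ t • 𝒦.cross a b :=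
  𝒦.cross_smul_left t a b

theorem cross_smul_r (t : K) (a b : J) : 𝒦.cross a (t • b) = σ t • 𝒦.cross a b := by
  rw [cross_symm, cross_smul_l, cross_symm]

theorem cross_neg_l (a b : J) : 𝒦.cross (-a) b = -𝒦.cross a b := by
  simpa using 𝒦.cross_smul_l (-1) a b

theorem cross_neg_r (a b : J) : 𝒦.cross a (-b) = -𝒦.cross a b := by
  simpa using 𝒦.cross_smul_r (-1) a b

theorem cross_sub_l (a b c : J) : 𝒦.cross (a - b) c = 𝒦.cross a c - 𝒦.cross b c := by
  rw [sub_eq_add_neg, cross_add_l, cross_neg_l, sub_eq_add_neg]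

theorem cross_sub_r (a b c : J) : 𝒦.cross a (b - c) = 𝒦.cross a b - 𝒦.cross a c := by
  rw [sub_eq_add_neg, cross_add_r, cross_neg_r, sub_eq_add_neg]

theorem trace_smul_left (t : K) (a b : J) : 𝒦.trace (t • a) b = t * 𝒦.trace a b := by
  simpa using 𝒦.trace_smul t 1 a b

theorem trace_smul_right (t : K) (a b : J) : 𝒦.trace a (t • b) = σ t * 𝒦.trace a b := by
  simpa using 𝒦.trace_smul 1 t a b

theorem trace_neg_left (a b : J) : 𝒦.trace (-a) b = -𝒦.trace a b := by
  simpa using 𝒦.trace_smul_left (-1) a b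

theorem trace_neg_right (a b : J) : 𝒦.trace a (-b) = -𝒦.trace a b := by
  simpa using 𝒦.trace_smul_right (-1) a b

theorem trace_sub_left (a b c : J) : 𝒦.trace (a - b) c = 𝒦.trace a c - 𝒦.trace b c := by
  rw [sub_eq_add_neg, trace_add_left, trace_neg_left, sub_eq_add_neg]

theorem trace_sub_right (a b c : J) : 𝒦.trace a (b - c) = 𝒦.trace a b - 𝒦.trace a c := by
  rw [sub_eq_add_neg, trace_add_right, trace_neg_right, sub_eq_add_neg]

theorem sharp_add (a b : J) : 𝒦.sharp (a + b) = 𝒦.sharp a + 𝒦.sharp b + 𝒦.cross a b := by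
  simp only [cross, QuadraticMap.polar]; abel

theorem sharp_neg (a : J) : 𝒦.sharp (-a) = 𝒦.sharp a := by
  simpa using 𝒦.sharp_smul (-1) a

theorem sharp_sub (a b : J) : 𝒦.sharp (a - b) = 𝒦.sharp a + 𝒦.sharp b - 𝒦.cross a b := by
  rw [sub_eq_add_neg, sharp_add, sharp_neg, cross_neg_r, ← sub_eq_add_neg]

theorem norm_neg (a : J) : 𝒦.norm (-a) = -𝒦.norm a := by
  have h := 𝒦.norm_smul (-1) a
  rw [neg_one_smul] at h
  rw [h]; ring

theorem norm_zero : 𝒦.norm 0 = 0 := by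
  simpa using 𝒦.norm_smul 0 0

theorem cross_self (a : J) : 𝒦.cross a a = (2 : K) • 𝒦.sharp a := by
  have h := 𝒦.sharp_smul 2 a
  rw [two_smul, sharp_add, map_ofNat] at h
  linear_combination (norm := module) h

/-- The form `T(a, b × c)`, which is symmetric in all three variables: it is the full
polarization of the cubic form `N`. -/
theorem trace_cross (a b c : J) : 𝒦.trace a (𝒦.cross b c) = 𝒦.trace b (𝒦.cross a c) := by
  have h₁ := 𝒦.norm_add (a + c) b
  have h₂ := 𝒦.norm_add a (b + c)
  have h₃ := 𝒦.norm_add a c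
  have h₄ := 𝒦.norm_add b c
  rw [show a + c + b = a + (b + c) by abel] at h₁
  simp only [sharp_add, trace_add_left, trace_add_right] at h₁ h₂ h₃ h₄
  linear_combination h₁ - h₂ + h₃ - h₄

theorem trace_self_cross (a b : J) :
    𝒦.trace a (𝒦.cross a b) = 2 * 𝒦.trace b (𝒦.sharp a) := by
  rw [cross_symm, trace_cross, 𝒦.cross_self, trace_smul_right, map_ofNat]

variable (h6 : IsUnit (6 : K))
include h6

theorem two_smul_cancel {x : J} (h : (2 : K) • x = 0) : x = 0 :=
  h6.smul_eq_zero.1 (by rw [show (6 : K) = 3 * 2 by norm_num, mul_smul, h, smul_zero])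

theorem trace_self_sharp (a : J) : 𝒦.trace a (𝒦.sharp a) = 3 * 𝒦.norm a := by
  have h := 𝒦.norm_add a a
  have h' := 𝒦.norm_smul 2 a
  rw [two_smul] at h'
  refine h6.mul_right_inj.1 ?_
  linear_combination 3 * h' - 3 * h

theorem trace_sharp_self' (a : J) : 𝒦.trace (𝒦.sharp a) a = 3 * σ (𝒦.norm a) := by
  rw [← trace_herm, 𝒦.trace_self_sharp h6, map_mul, map_ofNat]

/-- The components of `(a + b)^♯^♯ = N(a + b) (a + b)` of bidegree `(2, 2)` and `(3, 1)`. -/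
theorem sharp_cross_aux (a b : J) :
    𝒦.sharp (𝒦.cross a b) + 𝒦.cross (𝒦.sharp a) (𝒦.sharp b) =
      𝒦.trace b (𝒦.sharp a) • b + 𝒦.trace a (𝒦.sharp b) • a ∧
    𝒦.cross (𝒦.sharp a) (𝒦.cross a b) =
      𝒦.norm a • b + 𝒦.trace b (𝒦.sharp a) • a := by
  have key : ∀ b : J, 𝒦.cross (𝒦.sharp a) (𝒦.cross a b) + 𝒦.cross (𝒦.sharp b) (𝒦.cross a b) +
      𝒦.sharp (𝒦.cross a b) + 𝒦.cross (𝒦.sharp a) (𝒦.sharp b) =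
      (𝒦.trace b (𝒦.sharp a) + 𝒦.trace a (𝒦.sharp b) + 𝒦.norm b) • a +
      (𝒦.norm a + 𝒦.trace b (𝒦.sharp a) + 𝒦.trace a (𝒦.sharp b)) • b := fun b => by
    have h := 𝒦.sharp_sharp (a + b)
    simp only [sharp_add, cross_add_l, sharp_sharp, norm_add] at h
    linear_combination (norm := module) h
  have h₁ := key b
  have h₂ := key (-b)
  have h₃ := key ((2 : K) • b)
  simp only [cross_neg_r, sharp_neg, trace_neg_left, norm_neg] at h₂
  simp only [cross_smul_r, cross_smul_l, sharp_smul, trace_smul_left, trace_smul_right, norm_smul,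
    map_ofNat, map_pow] at h₃
  constructor
  · rw [← sub_eq_zero]
    refine two_smul_cancel h6 ?_
    linear_combination (norm := module) h₁ + h₂
  · rw [← sub_eq_zero]
    refine h6.smul_eq_zero.1 ?_
    linear_combination (norm := module) (6 : K) • h₁ - (2 : K) • h₂ - h₃

theorem sharp_cross (a b : J) : 𝒦.sharp (𝒦.cross a b) =
    𝒦.trace b (𝒦.sharp a) • b + 𝒦.trace a (𝒦.sharp b) • a - 𝒦.cross (𝒦.sharp a) (𝒦.sharp b) :=
  eq_sub_of_add_eq (𝒦.sharp_cross_aux h6 a b).1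

theorem cross_sharp_cross (a b : J) : 𝒦.cross (𝒦.sharp a) (𝒦.cross a b) =
    𝒦.norm a • b + 𝒦.trace b (𝒦.sharp a) • a :=
  (𝒦.sharp_cross_aux h6 a b).2

/-- The linearization of `cross_sharp_cross` in `a`. -/
theorem cross_cross_cross (a b c : J) : 𝒦.cross (𝒦.cross a c) (𝒦.cross a b) =
    𝒦.trace c (𝒦.sharp a) • b + 𝒦.trace b (𝒦.sharp a) • c + 𝒦.trace b (𝒦.cross a c) • a -
      𝒦.cross (𝒦.sharp a) (𝒦.cross c b) := by
  have h₁ := 𝒦.cross_sharp_cross h6 (a + c) b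
  have h₂ := 𝒦.cross_sharp_cross h6 (a - c) b
  have h₃ := 𝒦.cross_sharp_cross h6 c b
  have hn := 𝒦.norm_add a (-c)
  rw [← sub_eq_add_neg, sharp_neg, trace_neg_left, norm_neg] at hn
  simp only [sharp_add, sharp_sub, cross_add_l, cross_add_r, cross_sub_l, cross_sub_r,
    trace_add_right, trace_sub_right, norm_add, hn] at h₁ h₂
  rw [eq_sub_iff_add_eq, ← sub_eq_zero]
  refine two_smul_cancel h6 ?_
  linear_combination (norm := module) h₁ - h₂ - (2 : K) • h₃

/-! ### The operators `U_a` -/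

omit h6

/-- The operator `U_a(b) = T(a, b) a - a^♯ × b`; it is `σ`-semilinear in `b`. -/
def U (a b : J) : J := 𝒦.trace a b • a - 𝒦.cross (𝒦.sharp a) b

theorem U_add (a b c : J) : 𝒦.U a (b + c) = 𝒦.U a b + 𝒦.U a c := by
  simp only [U, trace_add_right, cross_add_r]; module

theorem U_smul (t : K) (a b : J) : 𝒦.U a (t • b) = σ t • 𝒦.U a b := by
  simp only [U, trace_smul_right, cross_smul_r]; module

theorem U_sub (a b c : J) : 𝒦.U a (b - c) = 𝒦.U a b - 𝒦.U a c := by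
  simp only [U, trace_sub_right, cross_sub_r]; module

/-- `U_a` is self-adjoint up to `σ`. -/
theorem trace_U (a b c : J) : 𝒦.trace (𝒦.U a b) c = 𝒦.trace (𝒦.U a c) b := by
  have h : 𝒦.trace (𝒦.cross (𝒦.sharp a) b) c = 𝒦.trace (𝒦.cross (𝒦.sharp a) c) b := by
    rw [← trace_herm, trace_cross, cross_symm, trace_cross, trace_herm, cross_symm]
  simp only [U, trace_sub_left, trace_smul_left, h]
  ring

theorem U_smul_left (hσ : ∀ t, σ (σ t) = t) (t : K) (a b : J) :
    𝒦.U (t • a) b = t ^ 2 • 𝒦.U a b := by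
  simp only [U, trace_smul_left, sharp_smul, cross_smul_l, map_pow, hσ]; module

include h6

theorem U_sharp (a : J) : 𝒦.U a (𝒦.sharp a) = 𝒦.norm a • a := by
  rw [U, 𝒦.trace_self_sharp h6, cross_self, sharp_sharp]; module

theorem U_cross (a b : J) :
    𝒦.U a (𝒦.cross a b) = 𝒦.trace b (𝒦.sharp a) • a - 𝒦.norm a • b := by
  rw [U, 𝒦.trace_self_cross, 𝒦.cross_sharp_cross h6]; module

theorem norm_sharp (a : J) : 𝒦.norm (𝒦.sharp a) = σ (𝒦.norm a) ^ 2 := by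
  have h := 𝒦.trace_self_sharp h6 (𝒦.sharp a)
  rw [sharp_sharp, trace_smul_right, 𝒦.trace_sharp_self' h6] at h
  refine h6.mul_right_inj.1 ?_
  linear_combination -2 * h

theorem cross_cross_sharp {a : J} (ha : IsUnit (𝒦.norm a)) (b : J) :
    𝒦.cross a (𝒦.cross (𝒦.sharp a) b) = σ (𝒦.norm a) • b + 𝒦.trace b a • 𝒦.sharp a := by
  have h := 𝒦.cross_sharp_cross h6 (𝒦.sharp a) b
  rw [sharp_sharp, cross_smul_l, 𝒦.norm_sharp h6, trace_smul_right] at h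
  rw [← (ha.map σ).smul_left_cancel, h]
  module

theorem sharp_U {a : J} (ha : IsUnit (𝒦.norm a)) (b : J) :
    𝒦.sharp (𝒦.U a b) = 𝒦.U (𝒦.sharp a) (𝒦.sharp b) := by
  rw [U, U, sharp_sub, 𝒦.sharp_cross h6, sharp_smul, cross_smul_l, 𝒦.cross_cross_sharp h6 ha,
    trace_herm, sharp_sharp, trace_smul_right, cross_smul_l]
  module

variable (hσ : ∀ t, σ (σ t) = t)
include hσ

theorem U_U_sharp (a b : J) : 𝒦.U a (𝒦.U (𝒦.sharp a) b) = 𝒦.norm a ^ 2 • b := by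
  have h₁ := 𝒦.trace_self_cross a b
  have h₂ := 𝒦.cross_sharp_cross h6 a b
  have h₃ := 𝒦.trace_herm (𝒦.sharp a) b
  simp only [U, trace_sub_right, trace_smul_right, cross_sub_r, cross_smul_r, cross_smul_l, hσ, h₁,
    h₂, h₃, sharp_sharp, cross_self, 𝒦.trace_self_sharp h6]
  module

variable {a : J} (ha : IsUnit (𝒦.norm a))
include ha

theorem U_sharp_U (b : J) : 𝒦.U (𝒦.sharp a) (𝒦.U a b) = σ (𝒦.norm a) ^ 2 • b := by
  have h := 𝒦.U_U_sharp h6 hσ (𝒦.sharp a) b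
  rw [sharp_sharp, 𝒦.U_smul_left hσ, U_smul, 𝒦.norm_sharp h6, map_pow] at h
  have hs : IsUnit (σ (𝒦.norm a) ^ 2) := (ha.map σ).pow 2
  rw [← hs.smul_left_cancel, h, smul_smul]
  ring_nf

theorem U_sharp_U' (b : J) : 𝒦.U a (𝒦.sharp (𝒦.U a b)) = 𝒦.norm a ^ 2 • 𝒦.sharp b := by
  rw [𝒦.sharp_U h6 ha, 𝒦.U_U_sharp h6 hσ]

theorem norm_U (b : J) : 𝒦.norm (𝒦.U a b) = 𝒦.norm a ^ 2 * σ (𝒦.norm b) := by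
  have h := 𝒦.trace_self_sharp h6 (𝒦.U a b)
  rw [trace_U, 𝒦.U_sharp_U' h6 hσ ha, trace_smul_left, 𝒦.trace_sharp_self' h6] at h
  refine h6.mul_right_inj.1 ?_
  linear_combination -2 * h

/-- The instance `b = a` of the fundamental formula `U_{U_a(b)} = U_a U_b U_a`. Both sides are
semilinear, so it suffices to compare them on `a^♯` and on the elements `a × b`, which
span `J` by `cross_cross_sharp`. -/
theorem U_U_self (y : J) : 𝒦.U (𝒦.U a a) y = 𝒦.U a (𝒦.U a (𝒦.U a y)) := by
  -- `T(a, a)` and `T(a^♯, a^♯)` are fixed by `σ`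
  have hτ := 𝒦.trace_herm a a
  have hρ := 𝒦.trace_herm (𝒦.sharp a) (𝒦.sharp a)
  have hz : 𝒦.U a a = 𝒦.trace a a • a - 𝒦.cross a (𝒦.sharp a) := by
    rw [U, cross_symm]
  have hz' : 𝒦.sharp (𝒦.U a a) = 𝒦.trace (𝒦.sharp a) (𝒦.sharp a) • 𝒦.sharp a -
      σ (𝒦.norm a) • 𝒦.cross a (𝒦.sharp a) := by
    rw [𝒦.sharp_U h6 ha, U, sharp_sharp, cross_smul_l]
  have hx : 𝒦.cross (𝒦.sharp a) (𝒦.cross a (𝒦.sharp a)) =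
      𝒦.norm a • 𝒦.sharp a + 𝒦.trace (𝒦.sharp a) (𝒦.sharp a) • a :=
    𝒦.cross_sharp_cross h6 a (𝒦.sharp a)
  have hUz : 𝒦.U a (𝒦.U a a) = 𝒦.trace a a • 𝒦.U a a -
      (𝒦.trace (𝒦.sharp a) (𝒦.sharp a) • a - 𝒦.norm a • 𝒦.sharp a) := by
    conv_lhs => rw [hz]
    rw [U_sub, U_smul, hτ, 𝒦.U_cross h6]
  have h₁ : 𝒦.U (𝒦.U a a) (𝒦.sharp a) = 𝒦.U a (𝒦.U a (𝒦.U a (𝒦.sharp a))) := by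
    rw [𝒦.U_sharp h6, U_smul, U_smul, hσ, hUz, U.eq_1 𝒦 (𝒦.U a a), trace_U, 𝒦.U_sharp h6, hz',
      cross_sub_l, cross_smul_l, cross_smul_l, hρ, hσ, 𝒦.cross_symm (𝒦.cross a (𝒦.sharp a)), hx,
      cross_self, sharp_sharp, trace_smul_left]
    module
  have h₂ : ∀ b, 𝒦.U (𝒦.U a a) (𝒦.cross a b) = 𝒦.U a (𝒦.U a (𝒦.U a (𝒦.cross a b))) := by
    intro b
    have hb : 𝒦.trace a (𝒦.cross (𝒦.sharp a) b) = 𝒦.trace b (𝒦.cross a (𝒦.sharp a)) := by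
      rw [cross_symm, trace_cross]
    have hUU : 𝒦.U a (𝒦.U a b) = 𝒦.trace b a • 𝒦.U a a -
        (𝒦.trace b (𝒦.cross a (𝒦.sharp a)) • a -
          𝒦.cross (𝒦.sharp a) (𝒦.cross (𝒦.sharp a) b)) := by
      conv_lhs => rw [U.eq_1 𝒦 a b]
      rw [U_sub, U_smul, trace_herm, U.eq_1 𝒦 a (𝒦.cross _ _), hb]
    rw [𝒦.U_cross h6, U_sub, U_smul, U_smul, U_sub, U_smul, U_smul, hσ, hσ, hUz, hUU,
      U.eq_1 𝒦 (𝒦.U a a), trace_U, 𝒦.U_cross h6, hz', cross_sub_l, cross_smul_l, cross_smul_l,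
      hρ, hσ, 𝒦.cross_sharp_cross h6, 𝒦.cross_cross_cross h6, trace_sub_left, trace_smul_left,
      trace_smul_left]
    module
  have hy : σ (𝒦.norm a) • y = 𝒦.cross a (𝒦.cross (𝒦.sharp a) y) - 𝒦.trace y a • 𝒦.sharp a := by
    rw [𝒦.cross_cross_sharp h6 ha]; module
  have h₃ : 𝒦.U (𝒦.U a a) (σ (𝒦.norm a) • y) =
      𝒦.U a (𝒦.U a (𝒦.U a (σ (𝒦.norm a) • y))) := by
    rw [hy]
    simp only [U_sub _ (𝒦.U a a), U_sub _ a, U_smul, h₁, h₂, hσ]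
  simp only [U_smul, hσ] at h₃
  exact ha.smul_left_cancel.1 h₃

end Identities

end HermitianCubicNormStructure

/-! ### The autotopy `U_u` of the isotope with base point `u` -/

namespace HermitianCubicNormStructure

section Isotope

variable {F : Type u} [Field F] {K : Type v} [CommRing K] [Algebra F K]
  {σ : K ≃ₐ[F] K} {J : Type w} [AddCommGroup J] [Module K J]
  (𝒦 : HermitianCubicNormStructure σ J)

/-- The inverse of `U_u` when `N(u)` is invertible; the zero map otherwise. -/
noncomputable def Uinv (u d : J) : J :=
  σ (Ring.inverse (𝒦.norm u)) ^ 2 • 𝒦.U (𝒦.sharp u) d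

theorem Uinv_add (u b c : J) : 𝒦.Uinv u (b + c) = 𝒦.Uinv u b + 𝒦.Uinv u c := by
  simp only [Uinv, U_add, smul_add]

theorem Uinv_smul (u : J) (t : K) (b : J) : 𝒦.Uinv u (t • b) = σ t • 𝒦.Uinv u b := by
  simp only [Uinv, U_smul, smul_comm (σ t)]

variable (h6 : IsUnit (6 : K)) (hσ : ∀ t, σ (σ t) = t) {u : J} (hu : IsUnit (𝒦.norm u))
include h6 hσ hu

theorem U_Uinv (d : J) : 𝒦.U u (𝒦.Uinv u d) = d := by
  rw [Uinv, U_smul, 𝒦.U_U_sharp h6 hσ, map_pow, hσ, smul_smul, ← mul_pow,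
    Ring.inverse_mul_cancel _ hu, one_pow, one_smul]

theorem Uinv_U (d : J) : 𝒦.Uinv u (𝒦.U u d) = d := by
  rw [Uinv, 𝒦.U_sharp_U h6 hσ hu, smul_smul, ← mul_pow, ← map_mul,
    Ring.inverse_mul_cancel _ hu, map_one, one_pow, one_smul]

theorem trace_Uinv (b d : J) : 𝒦.trace b (𝒦.Uinv u d) = 𝒦.trace d (𝒦.Uinv u b) := by
  have h := 𝒦.trace_U u (𝒦.Uinv u b) (𝒦.Uinv u d)
  rwa [𝒦.U_Uinv h6 hσ hu, 𝒦.U_Uinv h6 hσ hu] at h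

theorem Uinv_sharp_Uinv (a : J) : 𝒦.Uinv u (𝒦.sharp (𝒦.Uinv u a)) =
    σ (Ring.inverse (𝒦.norm u)) ^ 2 • 𝒦.sharp a := by
  have h := 𝒦.U_sharp_U' h6 hσ hu (𝒦.Uinv u a)
  rw [𝒦.U_Uinv h6 hσ hu] at h
  have h' := congrArg (𝒦.Uinv u) h
  rw [𝒦.Uinv_U h6 hσ hu, Uinv_smul, map_pow] at h'
  rw [h', smul_smul, ← mul_pow, ← map_mul, Ring.inverse_mul_cancel _ hu, map_one, one_pow, one_smul]

theorem Uinv_self : 𝒦.Uinv u u = σ (Ring.inverse (𝒦.norm u)) • 𝒦.sharp u := by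
  have h := congrArg (𝒦.Uinv u) (𝒦.U_sharp h6 u)
  rw [𝒦.Uinv_U h6 hσ hu, Uinv_smul] at h
  rw [h, smul_smul, ← map_mul, Ring.inverse_mul_cancel _ hu, map_one, one_smul]

omit hu h6 hσ in
theorem polar_isotope (u a b : J) :
    QuadraticMap.polar (fun d => 𝒦.norm u • 𝒦.sharp (𝒦.Uinv u d)) a b =
      𝒦.norm u • 𝒦.cross (𝒦.Uinv u a) (𝒦.Uinv u b) := by
  simp only [QuadraticMap.polar, Uinv_add, sharp_add]
  module

/-- The cubic norm structure over `K` on `J` with base point `u`, where `N(u)` is invertible: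
`T_u(b, d) = T(b, U_u⁻¹ d)`, `N_u = N(u)⁻¹ N` and `d ↦ N(u) (U_u⁻¹ d)^♯` is the sharp map. The
`σ`-semilinearity of `U_u⁻¹` compensates the one of the hermitian data. -/
noncomputable def isotope : CubicNormStructure K J where
  norm a := Ring.inverse (𝒦.norm u) * 𝒦.norm a
  sharp a := 𝒦.norm u • 𝒦.sharp (𝒦.Uinv u a)
  trace := LinearMap.mk₂ K (fun b d => 𝒦.trace b (𝒦.Uinv u d))
    (fun a b c => 𝒦.trace_add_left a b _) (fun t a b => 𝒦.trace_smul_left t a _)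
    (fun a b c => by rw [Uinv_add, trace_add_right])
    (fun t a b => by rw [Uinv_smul, trace_smul_right, hσ, smul_eq_mul])
  one := u
  trace_symm a b := 𝒦.trace_Uinv h6 hσ hu a b
  one_ne_zero := by
    rintro rfl
    obtain ⟨x, hx⟩ := Function.ne_iff.1 𝒦.norm_ne_zero
    have : Nontrivial K := ⟨_, _, hx⟩
    exact not_isUnit_zero (𝒦.norm_zero ▸ hu)
  cross_add_left a b c := by
    simp only [polar_isotope, Uinv_add, cross_add_l, smul_add]
  cross_smul_left t a b := by
    simp only [polar_isotope, Uinv_smul, cross_smul_l, hσ, smul_comm t]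
  sharp_smul t a := by
    rw [Uinv_smul, sharp_smul, hσ, smul_comm]
  norm_smul t a := by
    rw [norm_smul]; ring
  norm_add a b := by
    have h : ∀ a b, 𝒦.trace b (𝒦.Uinv u (𝒦.norm u • 𝒦.sharp (𝒦.Uinv u a))) =
        Ring.inverse (𝒦.norm u) * 𝒦.trace b (𝒦.sharp a) := fun a b => by
      rw [Uinv_smul, 𝒦.Uinv_sharp_Uinv h6 hσ hu, smul_smul, trace_smul_right, map_mul, map_pow,
        hσ, hσ, sq, ← mul_assoc, Ring.mul_inverse_cancel _ hu, one_mul]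
    simp only [LinearMap.mk₂_apply, h, norm_add]
    ring
  sharp_sharp a := by
    rw [Uinv_smul, 𝒦.Uinv_sharp_Uinv h6 hσ hu, smul_smul, sharp_smul, sharp_sharp, smul_smul,
      smul_smul, map_mul, map_pow, hσ, hσ]
    congr 1
    linear_combination Ring.inverse (𝒦.norm u) * 𝒦.norm a *
      ((𝒦.norm u * Ring.inverse (𝒦.norm u)) ^ 2 + 𝒦.norm u * Ring.inverse (𝒦.norm u) + 1) *
      Ring.mul_inverse_cancel _ hu
  sharp_one := by
    rw [𝒦.Uinv_self h6 hσ hu, sharp_smul, sharp_sharp, smul_smul, smul_smul, hσ]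
    convert one_smul K u
    linear_combination (𝒦.norm u * Ring.inverse (𝒦.norm u) + 1) * Ring.mul_inverse_cancel _ hu
  eq_sub_cross_one b := by
    rw [polar_isotope, LinearMap.mk₂_apply, 𝒦.trace_Uinv h6 hσ hu, 𝒦.Uinv_self h6 hσ hu,
      cross_smul_l, hσ, smul_smul, Ring.mul_inverse_cancel _ hu, one_smul]
    exact (𝒦.U_Uinv h6 hσ hu b).symm

theorem isotope_norm (a : J) :
    (𝒦.isotope h6 hσ hu).norm a = Ring.inverse (𝒦.norm u) * 𝒦.norm a := rfl

theorem isotope_sharp (a : J) :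
    (𝒦.isotope h6 hσ hu).sharp a = 𝒦.norm u • 𝒦.sharp (𝒦.Uinv u a) := rfl

theorem isotope_trace (a b : J) :
    (𝒦.isotope h6 hσ hu).trace a b = 𝒦.trace a (𝒦.Uinv u b) := rfl

theorem isotope_cross (a b : J) : (𝒦.isotope h6 hσ hu).cross a b =
    𝒦.norm u • 𝒦.cross (𝒦.Uinv u a) (𝒦.Uinv u b) :=
  𝒦.polar_isotope u a b

theorem norm_U_self : (𝒦.isotope h6 hσ hu).norm (𝒦.U u u) = 𝒦.norm u * σ (𝒦.norm u) := by
  rw [isotope_norm, 𝒦.norm_U h6 hσ hu]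
  linear_combination 𝒦.norm u * σ (𝒦.norm u) * Ring.inverse_mul_cancel _ hu

theorem isotope_U (y : J) :
    (𝒦.isotope h6 hσ hu).U (𝒦.U u u) y = 𝒦.U u (𝒦.U u y) := by
  have h := 𝒦.U_U_self h6 hσ hu (𝒦.Uinv u y)
  rw [𝒦.U_Uinv h6 hσ hu] at h
  rw [← h, CubicNormStructure.U, isotope_trace, isotope_cross, isotope_sharp, 𝒦.Uinv_U h6 hσ hu,
    Uinv_smul, cross_smul_l, hσ, smul_smul, U.eq_1 𝒦 (𝒦.U u u),
    𝒦.sharp_U h6 hu, Uinv.eq_1 𝒦 u (𝒦.sharp u), cross_smul_l, map_pow, hσ,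
    smul_smul]
  congr 1
  convert one_smul K _
  linear_combination (𝒦.norm u * Ring.inverse (𝒦.norm u) + 1) * Ring.mul_inverse_cancel _ hu

/-- `U_u` is a self-adjoint semilinear autotopy of the isotope with base point `u`, and the algebra
it defines with `γ = N(u)⁻¹` has the multiplication of the one defined by `𝒦`. -/
noncomputable def autotopy : SelfAdjointAutotopy σ J where
  __ := 𝒦.isotope h6 hσ hu
  φ :=
    { toFun := 𝒦.U u
      invFun := 𝒦.Uinv u
      left_inv := 𝒦.Uinv_U h6 hσ hu
      right_inv := 𝒦.U_Uinv h6 hσ hu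
      map_add' := 𝒦.U_add u }
  φ_smul t a := 𝒦.U_smul t u a
  isUnit_norm_φ_one := by
    change IsUnit ((𝒦.isotope h6 hσ hu).norm (𝒦.U u u))
    rw [norm_U_self]
    exact hu.mul (hu.map σ)
  φ_sharp a := by
    change 𝒦.U u ((𝒦.isotope h6 hσ hu).sharp a) =
      Ring.inverse ((𝒦.isotope h6 hσ hu).norm (𝒦.U u u)) •
        (𝒦.isotope h6 hσ hu).U (𝒦.U u u) ((𝒦.isotope h6 hσ hu).sharp (𝒦.U u a))
    rw [isotope_U, norm_U_self, isotope_sharp, isotope_sharp, 𝒦.Uinv_U h6 hσ hu]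
    have h := 𝒦.U_sharp_U' h6 hσ hu (𝒦.Uinv u a)
    rw [𝒦.U_Uinv h6 hσ hu] at h
    rw [U_smul, U_smul, h, smul_smul, U_smul, smul_smul, map_mul, map_pow, hσ]
    congr 1
    linear_combination -σ (𝒦.norm u) * Ring.inverse_mul_cancel _ (hu.mul (hu.map σ))
  selfAdjoint a := by
    change 𝒦.Uinv u ((𝒦.isotope h6 hσ hu).U (𝒦.U u u) a) = 𝒦.U u a
    rw [isotope_U, 𝒦.Uinv_U h6 hσ hu]
  γ := Ring.inverse (𝒦.norm u)
  γ_mul := by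
    change Ring.inverse (𝒦.norm u) * σ (Ring.inverse (𝒦.norm u)) =
      Ring.inverse ((𝒦.isotope h6 hσ hu).norm (𝒦.U u u))
    rw [norm_U_self, Ring.mul_inverse_rev, mul_comm]
    congr 1
    refine (hu.map σ).mul_left_cancel ?_
    rw [← map_mul, Ring.mul_inverse_cancel _ hu, Ring.mul_inverse_cancel _ (hu.map σ), map_one]

/-- The identity map of `K ⊕ J` is an isomorphism between the algebra of the autotopy `U_u` and the
algebra `𝒜(𝒦)`. -/
noncomputable def autotopyEquiv : InvolutionAlgEquiv F
    (SelfAdjointAutotopy.Alg.involution (𝒦.autotopy h6 hσ hu)) (Alg.involution 𝒦) where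
  toFun x := x
  invFun x := x
  left_inv _ := rfl
  right_inv _ := rfl
  map_add' _ _ := rfl
  map_smul' _ _ := rfl
  map_inv _ := rfl
  map_mul := by
    rintro ⟨s, b⟩ ⟨t, c⟩
    refine Prod.ext ?_ ?_
    · change s * t + (𝒦.isotope h6 hσ hu).trace b (𝒦.U u c) = s * t + 𝒦.trace b c
      rw [isotope_trace, 𝒦.Uinv_U h6 hσ hu]
    · change s • c + σ t • b + Ring.inverse (𝒦.norm u) •
        (𝒦.isotope h6 hσ hu).cross (𝒦.U u b) (𝒦.U u c) = s • c + σ t • b + 𝒦.cross b c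
      rw [isotope_cross, 𝒦.Uinv_U h6 hσ hu, 𝒦.Uinv_U h6 hσ hu, smul_smul,
        Ring.inverse_mul_cancel _ hu, one_smul]

end Isotope

end HermitianCubicNormStructure

/-- Composition of isomorphisms of algebras with involution. -/
def InvolutionAlgEquiv.trans {F : Type*} [CommRing F] {A B C : Type*} [NonAssocRing A]
    [Module F A] [NonAssocRing B] [Module F B] [NonAssocRing C] [Module F C]
    {ιA : A →ₗ[F] A} {ιB : B →ₗ[F] B} {ιC : C →ₗ[F] C}
    (e : InvolutionAlgEquiv F ιA ιB) (f : InvolutionAlgEquiv F ιB ιC) :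
    InvolutionAlgEquiv F ιA ιC where
  __ := e.toLinearEquiv.trans f.toLinearEquiv
  map_mul x y := (congrArg f.toLinearEquiv (e.map_mul x y)).trans (f.map_mul _ _)
  map_inv x := (congrArg f.toLinearEquiv (e.map_inv x)).trans (f.map_inv _)

/-! ### Quadratic étale algebras -/

/-- `F[s]` with `s² = μ ≠ 0` is étale: in a square-zero extension, a square root of the unit `μ` is
determined by its residue class. -/
theorem QuadraticAlgebra.isQuadraticEtale {F : Type u} [Field F] (h2 : (2 : F) ≠ 0) {μ : F}
    (hμ : μ ≠ 0) : IsQuadraticEtale F (QuadraticAlgebra F μ 0) := by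
  have : Algebra.FormallyUnramified F (QuadraticAlgebra F μ 0) := by
    rw [Algebra.FormallyUnramified.iff_comp_injective]
    intro B _ _ I hI f₁ f₂ hf
    refine QuadraticAlgebra.algHom_ext ?_
    have hd : f₁ omega - f₂ omega ∈ I := by
      simpa [Ideal.Quotient.mk_eq_mk_iff_sub_mem] using AlgHom.congr_fun hf omega
    have hd2 : (f₁ omega - f₂ omega) ^ 2 = 0 := by
      simpa [hI] using Ideal.pow_mem_pow hd 2
    have homega : (omega : QuadraticAlgebra F μ 0) * omega = algebraMap F _ μ := by
      rw [omega_mul_omega_eq_algebraMap]; simp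
    have h₁ : f₁ omega * f₁ omega = algebraMap F B μ := by rw [← map_mul, homega, AlgHom.commutes]
    have h₂ : f₂ omega * f₂ omega = algebraMap F B μ := by rw [← map_mul, homega, AlgHom.commutes]
    have hu : IsUnit (2 * f₂ omega) := by
      have h : IsUnit ((2 * f₂ omega) * (2 * f₂ omega)) := by
        rw [show (2 * f₂ omega) * (2 * f₂ omega) = algebraMap F B (2 * 2 * μ) by
          simp only [map_mul, map_ofNat, ← h₂]; ring]
        exact (isUnit_iff_ne_zero.2 (mul_ne_zero (mul_ne_zero h2 h2) hμ)).map _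
      exact isUnit_of_mul_isUnit_left h
    have h : (2 * f₂ omega) * (f₁ omega - f₂ omega) = 0 := by linear_combination h₁ - h₂ - hd2
    exact sub_eq_zero.1 (hu.mul_right_eq_zero.1 h)
  have := Algebra.FormallyEtale.of_formallyUnramified_of_field F (QuadraticAlgebra F μ 0)
  exact ⟨{ finitePresentation := Algebra.FinitePresentation.of_finiteType.1 inferInstance },
    QuadraticAlgebra.finrank_eq_two _ _⟩

/-- `F[s]` with `s² = μ` has a copy in every universe into which `F` embeds. -/
theorem exists_isQuadraticEtale {F : Type u} [Field F] [Small.{w} F] (h2 : (2 : F) ≠ 0) {μ : F}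
    (hμ : μ ≠ 0) : ∃ (K : Type w) (_ : CommRing K) (_ : Algebra F K)
      (_ : QuadraticAlgebra F μ 0 ≃ₐ[F] K), IsQuadraticEtale F K := by
  have : Small.{w} (QuadraticAlgebra F μ 0) :=
    small_of_injective (QuadraticAlgebra.equivProd μ 0).injective
  let ψ := (Shrink.algEquiv.{w} F (QuadraticAlgebra F μ 0)).symm
  obtain ⟨h, h'⟩ := QuadraticAlgebra.isQuadraticEtale h2 hμ
  exact ⟨_, _, _, ψ, Algebra.Etale.of_equiv ψ, ψ.toLinearEquiv.finrank_eq ▸ h'⟩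

/-! ### Descent of hermitian cubic norm structures -/

namespace CubicNormStructure

variable {K : Type u} [CommRing K] {J : Type v} [AddCommGroup J] [Module K J]
  (𝒥 : CubicNormStructure K J)

theorem cross_smul_l (t : K) (a b : J) : 𝒥.cross (t • a) b = t • 𝒥.cross a b :=
  𝒥.cross_smul_left t a b

theorem cross_smul_r (t : K) (a b : J) : 𝒥.cross a (t • b) = t • 𝒥.cross a b := by
  rw [cross_symm, cross_smul_l, cross_symm]

theorem cross_self (a : J) : 𝒥.cross a a = (2 : K) • 𝒥.sharp a := by
  have h := 𝒥.sharp_smul 2 a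
  rw [cross, QuadraticMap.polar, ← two_smul K, h]
  module

end CubicNormStructure

theorem CubicNormStructure.trace_self_sharp {K : Type u} [Field K] {J : Type v} [AddCommGroup J]
    [Module K J] (𝒥 : CubicNormStructure K J) (h2 : (2 : K) ≠ 0) (a : J) :
    𝒥.trace a (𝒥.sharp a) = 3 * 𝒥.norm a := by
  have h := 𝒥.norm_add a a
  have h' := 𝒥.norm_smul 2 a
  rw [two_smul] at h'
  refine mul_left_cancel₀ h2 ?_
  linear_combination h' - h

/-- There is a `σ`-hermitian cubic norm structure with a given sesquilinear form `T` and product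
`cr`, if these become those of the matrix algebra of `𝒥` and `η` under `κ : K → E` and
`p₁, p₂ : J → J₀`. The two maps `κ` and `κ ∘ σ`, and likewise `p₁` and `p₂`, are jointly injective,
so that all axioms can be read off from `𝒥`. -/
theorem HermitianCubicNormStructure.exists_of_split {F : Type*} [Field F] {K : Type*} [CommRing K]
    [Algebra F K] (σ : K ≃ₐ[F] K) (hσ : ∀ t, σ (σ t) = t) {J : Type*} [AddCommGroup J] [Module K J]
    {E : Type*} [Field E] [Algebra F E] {J₀ : Type*} [AddCommGroup J₀] [Module E J₀]
    (𝒥 : CubicNormStructure E J₀) {η : E} (hη : η ≠ 0)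
    (h2 : (2 : F) ≠ 0) (h3 : (3 : F) ≠ 0)
    (κ : K →ₐ[F] E) (hκ : ∀ k, κ k = 0 → κ (σ k) = 0 → k = 0)
    (p₁ p₂ : J →+ J₀) (hp : ∀ b, p₁ b = 0 → p₂ b = 0 → b = 0)
    (hp₁ : ∀ k b, p₁ (k • b) = κ k • p₁ b) (hp₂ : ∀ k b, p₂ (k • b) = κ (σ k) • p₂ b)
    (T : J → J → K) (cr : J → J → J)
    (hT₁ : ∀ b c, κ (T b c) = η * 𝒥.trace (p₁ b) (p₂ c))
    (hT₂ : ∀ b c, κ (σ (T b c)) = η * 𝒥.trace (p₂ b) (p₁ c))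
    (hc₁ : ∀ b c, p₁ (cr b c) = η • 𝒥.cross (p₂ b) (p₂ c))
    (hc₂ : ∀ b c, p₂ (cr b c) = 𝒥.cross (p₁ b) (p₁ c))
    (hN : ∃ b, 𝒥.norm (p₁ b) ≠ 0) :
    ∃ 𝒦 : HermitianCubicNormStructure σ J, (∀ b c, 𝒦.trace b c = T b c) ∧
      (∀ b c, 𝒦.cross b c = cr b c) ∧ (∀ b, κ (𝒦.norm b) = η * 𝒥.norm (p₁ b)) ∧
      ∀ b, κ (σ (𝒦.norm b)) = η ^ 2 * 𝒥.norm (p₂ b) := by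
  have h2' : (2 : E) ≠ 0 := by
    rw [← map_ofNat (algebraMap F E) 2]
    exact (map_ne_zero _).2 h2
  have h3' : (3 : E) ≠ 0 := by
    rw [← map_ofNat (algebraMap F E) 3]
    exact (map_ne_zero _).2 h3
  have hκ' : ∀ {k l : K}, κ k = κ l → κ (σ k) = κ (σ l) → k = l := fun h h' =>
    sub_eq_zero.1 (hκ _ (by rw [map_sub, h, sub_self]) (by rw [map_sub, map_sub, h', sub_self]))
  have hp' : ∀ {b c : J}, p₁ b = p₁ c → p₂ b = p₂ c → b = c := fun h h' =>
    sub_eq_zero.1 (hp _ (by rw [map_sub, h, sub_self]) (by rw [map_sub, h', sub_self]))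
  let sharp : J → J := fun b => algebraMap F K 2⁻¹ • cr b b
  have hs₁ : ∀ b, p₁ (sharp b) = η • 𝒥.sharp (p₂ b) := fun b => by
    simp only [sharp, hp₁, AlgHom.commutes, hc₁, 𝒥.cross_self, map_inv₀, map_ofNat]
    rw [smul_comm η, inv_smul_smul₀ h2']
  have hs₂ : ∀ b, p₂ (sharp b) = 𝒥.sharp (p₁ b) := fun b => by
    simp only [sharp, hp₂, AlgEquiv.commutes, AlgHom.commutes, hc₂, 𝒥.cross_self, map_inv₀,
      map_ofNat]
    rw [inv_smul_smul₀ h2']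
  have hn₁ : ∀ b, κ (algebraMap F K 3⁻¹ * T b (sharp b)) = η * 𝒥.norm (p₁ b) := fun b => by
    rw [map_mul, hT₁, hs₂, 𝒥.trace_self_sharp h2', AlgHom.commutes, map_inv₀, map_ofNat]
    field_simp
  have hn₂ : ∀ b, κ (σ (algebraMap F K 3⁻¹ * T b (sharp b))) = η ^ 2 * 𝒥.norm (p₂ b) := fun b => by
    rw [map_mul, map_mul, hT₂, hs₁, map_smul, 𝒥.trace_self_sharp h2', AlgEquiv.commutes,
      AlgHom.commutes, map_inv₀, map_ofNat, smul_eq_mul]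
    field_simp
  have hpolar : ∀ a b, QuadraticMap.polar sharp a b = cr a b := fun a b => by
    refine hp' ?_ ?_
    · rw [hc₁]
      simp only [QuadraticMap.polar, CubicNormStructure.cross, map_sub, map_add, hs₁, smul_sub]
    · rw [hc₂]
      simp only [QuadraticMap.polar, CubicNormStructure.cross, map_sub, map_add, hs₂]
  refine ⟨{
    norm := fun b => algebraMap F K 3⁻¹ * T b (sharp b)
    sharp := sharp
    trace := T
    norm_ne_zero := by
      obtain ⟨b, hb⟩ := hN
      intro h
      have h' := hn₁ b
      rw [show algebraMap F K 3⁻¹ * T b (sharp b) = 0 from congrFun h b, map_zero] at h'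
      exact mul_ne_zero hη hb h'.symm
    trace_add_left := fun a b c => by
      refine hκ' ?_ ?_ <;> simp [hT₁, hT₂, mul_add]
    trace_smul := fun s t a b => by
      refine hκ' ?_ ?_ <;> simp [hT₁, hT₂, hp₁, hp₂, hσ] <;> ring
    trace_herm := fun a b => by
      refine hκ' ?_ ?_
      · rw [hT₂, hT₁, 𝒥.trace_symm]
      · rw [hσ, hT₂, hT₁, 𝒥.trace_symm]
    cross_add_left := fun a b c => by
      simp only [hpolar]
      refine hp' ?_ ?_ <;> simp [hc₁, hc₂, 𝒥.cross_add_l]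
    cross_smul_left := fun t a b => by
      simp only [hpolar]
      refine hp' ?_ ?_ <;> simp [hc₁, hc₂, hp₁, hp₂, 𝒥.cross_smul_l, hσ, smul_comm η]
    sharp_smul := fun t a => by
      refine hp' ?_ ?_ <;> simp [hs₁, hs₂, hp₁, hp₂, 𝒥.sharp_smul, hσ, smul_comm η]
    norm_smul := fun t a => by
      refine hκ' ?_ ?_
      · rw [hn₁, hp₁, 𝒥.norm_smul, map_mul, map_pow, hn₁]; ring
      · rw [hn₂, hp₂, 𝒥.norm_smul, map_mul, map_pow, map_mul, map_pow, hn₂]; ring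
    norm_add := fun a b => by
      refine hκ' ?_ ?_
      · simp only [map_add κ, hn₁, hT₁, hs₂, map_add p₁, 𝒥.norm_add]; ring
      · simp only [map_add κ, map_add σ, hn₂, hT₂, hs₁, map_add p₂, 𝒥.norm_add, map_smul,
          smul_eq_mul]
        ring
    sharp_sharp := fun a => by
      refine hp' ?_ ?_
      · rw [hs₁, hs₂, hp₁, hn₁, 𝒥.sharp_sharp, smul_smul]
      · rw [hs₂, hs₁, hp₂, hn₂, 𝒥.sharp_smul, 𝒥.sharp_sharp, smul_smul] },
    fun _ _ => rfl, hpolar, hn₁, hn₂⟩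

/-! ### Forms of matrix algebras and their skew elements -/

/-- An algebra with involution `(A, ι)` over `F` viewed inside the matrix algebra of `𝒥` and `η`
over an extension `E` of `F`, of which it is an `F`-form: `d₁, p₁, p₂, d₂` are the four entries of
the matrix of an element of `A`. Of the fact that `A` spans the matrix algebra and that elements of
`A` are independent over `E` if they are so over `F`, only the consequences in the last four fields
are needed. -/
structure MatrixForm {F : Type u} [Field F] {E : Type v} [Field E] [Algebra F E]
    {A : Type w} [NonAssocRing A] [Module F A] (ι : A →ₗ[F] A)
    {J₀ : Type x} [AddCommGroup J₀] [Module E J₀] (𝒥 : CubicNormStructure E J₀) (η : E) where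
  d₁ : A →ₗ[F] E
  d₂ : A →ₗ[F] E
  p₁ : A →+ J₀
  p₂ : A →+ J₀
  p₁_smul : ∀ (r : F) (a : A), p₁ (r • a) = algebraMap F E r • p₁ a
  p₂_smul : ∀ (r : F) (a : A), p₂ (r • a) = algebraMap F E r • p₂ a
  ext_zero : ∀ a, d₁ a = 0 → d₂ a = 0 → p₁ a = 0 → p₂ a = 0 → a = 0
  d₁_mul : ∀ a b, d₁ (a * b) = d₁ a * d₁ b + η * 𝒥.trace (p₁ a) (p₂ b)
  d₂_mul : ∀ a b, d₂ (a * b) = d₂ a * d₂ b + η * 𝒥.trace (p₂ a) (p₁ b)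
  p₁_mul : ∀ a b, p₁ (a * b) = d₁ a • p₁ b + d₂ b • p₁ a + η • 𝒥.cross (p₂ a) (p₂ b)
  p₂_mul : ∀ a b, p₂ (a * b) = d₂ a • p₂ b + d₁ b • p₂ a + 𝒥.cross (p₁ a) (p₁ b)
  d₁_one : d₁ 1 = 1
  d₂_one : d₂ 1 = 1
  p₁_one : p₁ 1 = 0
  p₂_one : p₂ 1 = 0
  d₁_inv : ∀ a, d₁ (ι a) = d₂ a
  d₂_inv : ∀ a, d₂ (ι a) = d₁ a
  p₁_inv : ∀ a, p₁ (ι a) = p₁ a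
  p₂_inv : ∀ a, p₂ (ι a) = p₂ a
  descent : ∀ (a b : A) (c : E), a ≠ 0 → d₁ b = c * d₁ a → d₂ b = c * d₂ a →
    p₁ b = c • p₁ a → p₂ b = c • p₂ a → ∃ r : F, b = r • a
  exists_diag : ∃ a, d₁ a ≠ d₂ a
  exists_norm₁ : ∃ a, 𝒥.norm (p₁ a) ≠ 0
  exists_norm₂ : ∃ a, 𝒥.norm (p₂ a) ≠ 0

namespace MatrixForm

variable {F : Type u} [Field F] {E : Type v} [Field E] [Algebra F E]
    {A : Type w} [NonAssocRing A] [Module F A] {ι : A →ₗ[F] A}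
    {J₀ : Type x} [AddCommGroup J₀] [Module E J₀] {𝒥 : CubicNormStructure E J₀} {η : E}
    (D : MatrixForm ι 𝒥 η)

theorem ext {a b : A} (h₁ : D.d₁ a = D.d₁ b) (h₂ : D.d₂ a = D.d₂ b) (h₃ : D.p₁ a = D.p₁ b)
    (h₄ : D.p₂ a = D.p₂ b) : a = b :=
  sub_eq_zero.1 (D.ext_zero _ (by rw [map_sub, h₁, sub_self]) (by rw [map_sub, h₂, sub_self])
    (by rw [map_sub, h₃, sub_self]) (by rw [map_sub, h₄, sub_self]))

/-- A generator `s` of the space of skew elements: its matrix is `diag(lam, -lam)`, and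
`s² = μ` is a nonzero element of `F`. -/
structure SkewGenerator where
  s : A
  lam : E
  μ : F
  d₁_s : D.d₁ s = lam
  d₂_s : D.d₂ s = -lam
  p₁_s : D.p₁ s = 0
  p₂_s : D.p₂ s = 0
  lam_mul : lam * lam = algebraMap F E μ
  μ_ne_zero : μ ≠ 0
  eq_smul : ∀ x, ι x = -x → ∃ r : F, x = r • s

theorem two_ne_zero_of_algebra (h2 : (2 : F) ≠ 0) : (2 : E) ≠ 0 := by
  rw [← map_ofNat (algebraMap F E) 2]
  exact (map_ne_zero _).2 h2

theorem skew_entries (h2 : (2 : F) ≠ 0) {x : A} (hx : ι x = -x) :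
    D.d₂ x = -D.d₁ x ∧ D.p₁ x = 0 ∧ D.p₂ x = 0 := by
  have h2' : (2 : E) ≠ 0 := two_ne_zero_of_algebra h2
  have h : ∀ y : J₀, y = -y → y = 0 := fun y hy => by
    have : (2 : E) • y = 0 := by rw [two_smul]; nth_rewrite 1 [hy]; exact neg_add_cancel y
    exact (smul_eq_zero.1 this).resolve_left h2'
  refine ⟨?_, h _ ?_, h _ ?_⟩
  · rw [← D.d₁_inv, hx, map_neg]
  · nth_rewrite 1 [← D.p₁_inv, hx, map_neg]; rfl
  · nth_rewrite 1 [← D.p₂_inv, hx, map_neg]; rfl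

theorem exists_skewGenerator (h2 : (2 : F) ≠ 0) : Nonempty D.SkewGenerator := by
  have h2' : (2 : E) ≠ 0 := two_ne_zero_of_algebra h2
  obtain ⟨a, ha⟩ := D.exists_diag
  have hs : ι (a - ι a) = -(a - ι a) :=
    D.ext (by simp [D.d₁_inv, D.d₂_inv]) (by simp [D.d₁_inv, D.d₂_inv])
      (by simp [D.p₁_inv]) (by simp [D.p₂_inv])
  have hd : D.d₁ (a - ι a) ≠ 0 := by rw [map_sub, D.d₁_inv]; exact sub_ne_zero.2 ha
  generalize a - ι a = s at hs hd
  have hs0 : s ≠ 0 := by rintro rfl; exact hd (map_zero _)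
  obtain ⟨e₂, e₃, e₄⟩ := D.skew_entries h2 hs
  have h10 : (1 : A) ≠ 0 := fun h => one_ne_zero (α := E) (by rw [← D.d₁_one, h, map_zero])
  obtain ⟨μ, hμ⟩ := D.descent 1 (s * s) (D.d₁ s * D.d₁ s) h10
    (by rw [D.d₁_mul, e₃, D.d₁_one]; simp) (by rw [D.d₂_mul, e₃, e₂, D.d₂_one]; simp)
    (by rw [D.p₁_mul, e₃, e₄, D.p₁_one]; simp [𝒥.cross_zero_l])
    (by rw [D.p₂_mul, e₃, e₄, D.p₂_one]; simp [𝒥.cross_zero_l])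
  have hlam : D.d₁ s * D.d₁ s = algebraMap F E μ := by
    have h := congrArg D.d₁ hμ
    rwa [D.d₁_mul, e₃, map_zero, LinearMap.zero_apply, mul_zero, add_zero, map_smul, D.d₁_one,
      Algebra.smul_def, mul_one] at h
  refine ⟨⟨s, D.d₁ s, μ, rfl, e₂, e₃, e₄, hlam, ?_, fun x hx => ?_⟩⟩
  · rintro rfl
    rw [map_zero] at hlam
    exact hd (mul_self_eq_zero.1 hlam)
  · obtain ⟨f₂, f₃, f₄⟩ := D.skew_entries h2 hx
    refine D.descent s x (D.d₁ x / D.d₁ s) hs0 ?_ ?_ ?_ ?_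
    · field_simp
    · rw [f₂, e₂]; field_simp
    · rw [f₃, e₃, smul_zero]
    · rw [f₄, e₄, smul_zero]

namespace SkewGenerator

variable {D} (S : D.SkewGenerator)

theorem s_mul_s : S.s * S.s = S.μ • 1 := by
  refine D.ext ?_ ?_ ?_ ?_
  · rw [D.d₁_mul, S.p₁_s, S.d₁_s, map_smul, D.d₁_one, S.lam_mul, Algebra.smul_def]; simp
  · rw [D.d₂_mul, S.p₁_s, S.d₂_s, map_smul, D.d₂_one, neg_mul_neg, S.lam_mul, Algebra.smul_def]
    simp
  · rw [D.p₁_mul, S.p₁_s, S.p₂_s, D.p₁_smul, D.p₁_one, 𝒥.cross_zero_l]; simp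
  · rw [D.p₂_mul, S.p₁_s, S.p₂_s, D.p₂_smul, D.p₂_one, 𝒥.cross_zero_l]; simp

theorem lam_ne_zero : S.lam ≠ 0 := fun h => by
  have h' := S.lam_mul
  rw [h, mul_zero, eq_comm, map_eq_zero] at h'
  exact S.μ_ne_zero h'

theorem inv_s : ι S.s = -S.s := by
  refine D.ext ?_ ?_ ?_ ?_
  · rw [D.d₁_inv, S.d₂_s, map_neg, S.d₁_s]
  · rw [D.d₂_inv, S.d₁_s, map_neg, S.d₂_s, neg_neg]
  · rw [D.p₁_inv, map_neg, S.p₁_s, neg_zero]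
  · rw [D.p₂_inv, map_neg, S.p₂_s, neg_zero]

variable {K : Type*} [CommRing K] [Algebra F K] (ψ : QuadraticAlgebra F S.μ 0 ≃ₐ[F] K)

/-- The homomorphism `K = F[s] → E` with `s ↦ lam`, reading off the first diagonal entry. -/
noncomputable def kap : K →ₐ[F] E :=
  (QuadraticAlgebra.lift (⟨S.lam, by rw [S.lam_mul, Algebra.smul_def]; simp⟩ :
    { u : E // u * u = S.μ • 1 + (0 : F) • u })).comp ψ.symm.toAlgHom

theorem kap_ψ (z : QuadraticAlgebra F S.μ 0) : S.kap ψ (ψ z) =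
    algebraMap F E z.re + algebraMap F E z.im * S.lam := by
  simp [kap, Algebra.smul_def]

/-- The non-trivial automorphism of `K = F[s]`, mapping `s` to `-s`. -/
def conj (_S : D.SkewGenerator) (ψ : QuadraticAlgebra F _S.μ 0 ≃ₐ[F] K) : K ≃ₐ[F] K :=
  let c : QuadraticAlgebra F _S.μ 0 ≃ₐ[F] QuadraticAlgebra F _S.μ 0 :=
    { starRingAut (R := QuadraticAlgebra F _S.μ 0) with
      commutes' := fun r => by
        change star _ = _
        ext <;> simp }
  ψ.symm.trans (c.trans ψ)

theorem conj_ψ (z : QuadraticAlgebra F S.μ 0) : S.conj ψ (ψ z) = ψ ⟨z.re, -z.im⟩ := by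
  have : star z = ⟨z.re, -z.im⟩ := by ext <;> simp
  rw [← this]
  simp [conj]

theorem conj_conj (t : K) : S.conj ψ (S.conj ψ t) = t := by
  obtain ⟨z, rfl⟩ := ψ.surjective t
  rw [conj_ψ, conj_ψ, neg_neg]

theorem kap_conj_ψ (z : QuadraticAlgebra F S.μ 0) : S.kap ψ (S.conj ψ (ψ z)) =
    algebraMap F E z.re - algebraMap F E z.im * S.lam := by
  rw [conj_ψ, kap_ψ, map_neg, neg_mul, sub_eq_add_neg]

theorem eq_zero_of_kap (h2 : (2 : F) ≠ 0) (k : K) (h : S.kap ψ k = 0)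
    (h' : S.kap ψ (S.conj ψ k) = 0) : k = 0 := by
  obtain ⟨z, rfl⟩ := ψ.surjective k
  rw [kap_ψ] at h
  rw [kap_conj_ψ] at h'
  have h2' : (2 : E) ≠ 0 := two_ne_zero_of_algebra h2
  have hre : algebraMap F E z.re = 0 :=
    mul_left_cancel₀ h2' (by linear_combination h + h')
  have him : algebraMap F E z.im = 0 :=
    mul_right_cancel₀ S.lam_ne_zero (by linear_combination h - hre)
  rw [map_eq_zero] at hre him
  rw [show z = 0 from QuadraticAlgebra.ext hre him, map_zero]

theorem conj_ne_refl (h2 : (2 : F) ≠ 0) : S.conj ψ ≠ AlgEquiv.refl := fun h => by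
  have h' := congrArg (S.kap ψ) (DFunLike.congr_fun h (ψ ⟨0, 1⟩))
  rw [kap_conj_ψ, AlgEquiv.coe_refl, id, kap_ψ, map_one, map_zero, one_mul] at h'
  have h2' : (2 : E) ≠ 0 := two_ne_zero_of_algebra h2
  exact S.lam_ne_zero (mul_left_cancel₀ h2' (by linear_combination -h'))

/-- The embedding of `K = F[s]` into `A`. -/
noncomputable def ofK : K →ₗ[F] A where
  toFun k := (ψ.symm k).re • 1 + (ψ.symm k).im • S.s
  map_add' k l := by simp only [map_add, QuadraticAlgebra.re_add, QuadraticAlgebra.im_add]; module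
  map_smul' r k := by
    simp only [map_smul, QuadraticAlgebra.re_smul, QuadraticAlgebra.im_smul, smul_eq_mul,
      RingHom.id_apply]
    module

theorem ofK_ψ (z : QuadraticAlgebra F S.μ 0) : S.ofK ψ (ψ z) = z.re • 1 + z.im • S.s := by
  simp [ofK]

theorem d₁_ofK (k : K) : D.d₁ (S.ofK ψ k) = S.kap ψ k := by
  obtain ⟨z, rfl⟩ := ψ.surjective k
  rw [ofK_ψ, kap_ψ, map_add, map_smul, map_smul, D.d₁_one, S.d₁_s, Algebra.smul_def,
    Algebra.smul_def, mul_one]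

theorem d₂_ofK (k : K) : D.d₂ (S.ofK ψ k) = S.kap ψ (S.conj ψ k) := by
  obtain ⟨z, rfl⟩ := ψ.surjective k
  rw [ofK_ψ, kap_conj_ψ, map_add, map_smul, map_smul, D.d₂_one, S.d₂_s, Algebra.smul_def,
    Algebra.smul_def, mul_one, mul_neg, sub_eq_add_neg]

theorem p₁_ofK (k : K) : D.p₁ (S.ofK ψ k) = 0 := by
  obtain ⟨z, rfl⟩ := ψ.surjective k
  rw [ofK_ψ, map_add, D.p₁_smul, D.p₁_smul, D.p₁_one, S.p₁_s, smul_zero, smul_zero, add_zero]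

theorem p₂_ofK (k : K) : D.p₂ (S.ofK ψ k) = 0 := by
  obtain ⟨z, rfl⟩ := ψ.surjective k
  rw [ofK_ψ, map_add, D.p₂_smul, D.p₂_smul, D.p₂_one, S.p₂_s, smul_zero, smul_zero, add_zero]

end SkewGenerator

end MatrixForm

/-! ### The decomposition into `K` and the elements with zero diagonal -/

namespace MatrixForm.SkewGenerator

variable {F : Type u} [Field F] {E : Type v} [Field E] [Algebra F E]
    {A : Type w} [NonAssocRing A] [Module F A] {ι : A →ₗ[F] A}
    {J₀ : Type x} [AddCommGroup J₀] [Module E J₀] {𝒥 : CubicNormStructure E J₀} {η : E}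
    {D : MatrixForm ι 𝒥 η} (S : D.SkewGenerator)
    {K : Type*} [CommRing K] [Algebra F K] (ψ : QuadraticAlgebra F S.μ 0 ≃ₐ[F] K)

theorem ofK_one : S.ofK ψ 1 = 1 := by
  rw [← map_one ψ, ofK_ψ]
  simp [QuadraticAlgebra.re_one, QuadraticAlgebra.im_one]

theorem ofK_mul (k l : K) : S.ofK ψ (k * l) = S.ofK ψ k * S.ofK ψ l := by
  refine D.ext ?_ ?_ ?_ ?_ <;>
  simp [d₁_ofK, d₂_ofK, p₁_ofK, p₂_ofK, D.d₁_mul, D.d₂_mul, D.p₁_mul, D.p₂_mul, 𝒥.cross_zero_l]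

/-- The elements of `A` whose matrix has zero diagonal. -/
@[nolint unusedArguments]
def OffDiag (_ψ : QuadraticAlgebra F S.μ 0 ≃ₐ[F] K) : Type w :=
  ((LinearMap.ker D.d₁ ⊓ LinearMap.ker D.d₂ : Submodule F A) : Type w)

namespace OffDiag

instance : AddCommGroup (S.OffDiag ψ) :=
  inferInstanceAs (AddCommGroup (LinearMap.ker D.d₁ ⊓ LinearMap.ker D.d₂ : Submodule F A))

variable {S ψ}

/-- The inclusion into `A`. -/
def val : S.OffDiag ψ →+ A :=
  (LinearMap.ker D.d₁ ⊓ LinearMap.ker D.d₂ : Submodule F A).subtype.toAddMonoidHom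

theorem val_injective : Function.Injective (val : S.OffDiag ψ → A) := Subtype.val_injective

theorem d₁_val (b : S.OffDiag ψ) : D.d₁ b.val = 0 := b.2.1

theorem d₂_val (b : S.OffDiag ψ) : D.d₂ b.val = 0 := b.2.2

/-- An element of `A` with zero diagonal entries. -/
def mk (a : A) (h₁ : D.d₁ a = 0) (h₂ : D.d₂ a = 0) : S.OffDiag ψ := ⟨a, h₁, h₂⟩

theorem val_mk (a : A) (h₁ : D.d₁ a = 0) (h₂ : D.d₂ a = 0) :
    (mk a h₁ h₂ : S.OffDiag ψ).val = a := rfl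

theorem ext {b c : S.OffDiag ψ} (h₁ : D.p₁ b.val = D.p₁ c.val) (h₂ : D.p₂ b.val = D.p₂ c.val) :
    b = c :=
  val_injective (D.ext (by rw [d₁_val, d₁_val]) (by rw [d₂_val, d₂_val]) h₁ h₂)

/-- `K` acts by left multiplication in `A`. -/
noncomputable instance : SMul K (S.OffDiag ψ) where
  smul k b := mk (S.ofK ψ k * b.val)
    (by rw [D.d₁_mul, d₁_val, p₁_ofK]; simp) (by rw [D.d₂_mul, d₂_val, p₂_ofK]; simp)

theorem val_smul (k : K) (b : S.OffDiag ψ) : (k • b).val = S.ofK ψ k * b.val := rfl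

theorem p₁_smul (k : K) (b : S.OffDiag ψ) : D.p₁ (k • b).val = S.kap ψ k • D.p₁ b.val := by
  rw [val_smul, D.p₁_mul, d₁_ofK, p₁_ofK, p₂_ofK, 𝒥.cross_zero_l]; simp

theorem p₂_smul (k : K) (b : S.OffDiag ψ) :
    D.p₂ (k • b).val = S.kap ψ (S.conj ψ k) • D.p₂ b.val := by
  rw [val_smul, D.p₂_mul, d₂_ofK, p₁_ofK, p₂_ofK, 𝒥.cross_zero_l]; simp

noncomputable instance : Module K (S.OffDiag ψ) where
  one_smul b := ext (by simp [p₁_smul]) (by simp [p₂_smul])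
  mul_smul k l b := ext (by simp [p₁_smul, mul_smul]) (by simp [p₂_smul, mul_smul])
  smul_zero k := ext (by simp [p₁_smul]) (by simp [p₂_smul])
  smul_add k b c := ext (by simp [p₁_smul]) (by simp [p₂_smul])
  add_smul k l b := ext (by simp [p₁_smul, add_smul]) (by simp [p₂_smul, add_smul])
  zero_smul b := ext (by simp [p₁_smul]) (by simp [p₂_smul])

end OffDiag

section Decomposition

/-- Every element of `A` is a sum of an element of `K = F[s]` and one with zero diagonal: the two
parts of `a` are `(a ± μ⁻¹ s (a s)) / 2`. -/
theorem exists_decomp (h2 : (2 : F) ≠ 0) (a : A) :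
    ∃ (k : K) (b : S.OffDiag ψ), a = S.ofK ψ k + b.val := by
  have h2' : (2 : E) ≠ 0 := two_ne_zero_of_algebra h2
  have hμ : algebraMap F E S.μ ≠ 0 := (map_ne_zero _).2 S.μ_ne_zero
  -- an element with diagonal matrix is the sum of a multiple of `1` and a skew element
  have key : ∀ c : A, D.p₁ c = 0 → D.p₂ c = 0 → ∃ k : K, c = S.ofK ψ k := by
    intro c h₁ h₂
    have h10 : (1 : A) ≠ 0 := fun h => one_ne_zero (α := E) (by rw [← D.d₁_one, h, map_zero])
    obtain ⟨r, hr⟩ := D.descent 1 (c + ι c) (D.d₁ c + D.d₂ c) h10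
      (by rw [map_add, D.d₁_inv, D.d₁_one, mul_one])
      (by rw [map_add, D.d₂_inv, D.d₂_one, mul_one, add_comm])
      (by rw [map_add, D.p₁_inv, h₁, D.p₁_one]; simp)
      (by rw [map_add, D.p₂_inv, h₂, D.p₂_one]; simp)
    obtain ⟨t, ht⟩ := S.eq_smul (c - ι c) (D.ext (by simp [D.d₁_inv, D.d₂_inv])
      (by simp [D.d₁_inv, D.d₂_inv]) (by simp [D.p₁_inv]) (by simp [D.p₂_inv]))
    refine ⟨ψ ⟨2⁻¹ * r, 2⁻¹ * t⟩, ?_⟩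
    rw [ofK_ψ, mul_smul, mul_smul, ← hr, ← ht, ← smul_add, eq_inv_smul_iff₀ h2, two_smul]
    abel
  let b : A := (2 : F)⁻¹ • (a - S.μ⁻¹ • (S.s * (a * S.s)))
  have hb₁ : D.d₁ b = 0 := by
    simp only [b, map_smul, map_sub, D.d₁_mul, S.d₁_s, S.p₁_s, S.p₂_s]
    rw [Algebra.smul_def S.μ⁻¹, map_inv₀]
    simp only [map_zero, LinearMap.zero_apply, mul_zero, add_zero]
    rw [mul_left_comm S.lam, S.lam_mul, mul_comm (D.d₁ a), inv_mul_cancel_left₀ hμ, sub_self,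
      smul_zero]
  have hb₂ : D.d₂ b = 0 := by
    simp only [b, map_smul, map_sub, D.d₂_mul, S.d₂_s, S.p₁_s, S.p₂_s]
    rw [Algebra.smul_def S.μ⁻¹, map_inv₀]
    simp only [map_zero, LinearMap.zero_apply, mul_zero, add_zero]
    rw [mul_left_comm (-S.lam), neg_mul_neg, S.lam_mul, mul_comm (D.d₂ a),
      inv_mul_cancel_left₀ hμ, sub_self, smul_zero]
  have hs₁ : D.p₁ (S.s * (a * S.s)) = -(algebraMap F E S.μ • D.p₁ a) := by
    rw [D.p₁_mul, D.p₁_mul, S.d₁_s, S.d₂_s, S.p₁_s, S.p₂_s, 𝒥.cross_zero_r, 𝒥.cross_zero_l,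
      ← S.lam_mul]
    module
  have hs₂ : D.p₂ (S.s * (a * S.s)) = -(algebraMap F E S.μ • D.p₂ a) := by
    rw [D.p₂_mul, D.p₂_mul, S.d₁_s, S.d₂_s, S.p₁_s, S.p₂_s, 𝒥.cross_zero_r, 𝒥.cross_zero_l,
      ← S.lam_mul]
    module
  have hinv : ∀ y : J₀, algebraMap F E 2⁻¹ • (y - algebraMap F E S.μ⁻¹ •
      -(algebraMap F E S.μ • y)) = y := fun y => by
    rw [map_inv₀, map_inv₀, smul_neg, inv_smul_smul₀ hμ, map_ofNat, sub_neg_eq_add, ← two_smul E,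
      inv_smul_smul₀ h2']
  obtain ⟨k, hk⟩ := key (a - b)
    (by simp only [b, map_sub, D.p₁_smul, hs₁, hinv, sub_self])
    (by simp only [b, map_sub, D.p₂_smul, hs₂, hinv, sub_self])
  exact ⟨k, OffDiag.mk b hb₁ hb₂, by rw [OffDiag.val_mk, ← hk, sub_add_cancel]⟩

/-- The decomposition `A = K ⊕ J`. -/
noncomputable def decomp (h2 : (2 : F) ≠ 0) : K × S.OffDiag ψ ≃+ A :=
  AddEquiv.ofBijective
    ((S.ofK ψ).toAddMonoidHom.coprod OffDiag.val : K × S.OffDiag ψ →+ A)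
    ⟨by
      refine (injective_iff_map_eq_zero _).2 ?_
      rintro ⟨k, b⟩ h
      change S.ofK ψ k + b.val = 0 at h
      have hk : k = 0 := by
        refine S.eq_zero_of_kap ψ h2 k ?_ ?_
        · have h' := congrArg D.d₁ h
          rwa [map_add, d₁_ofK, OffDiag.d₁_val, add_zero, map_zero] at h'
        · have h' := congrArg D.d₂ h
          rwa [map_add, d₂_ofK, OffDiag.d₂_val, add_zero, map_zero] at h'
      rw [hk, map_zero, zero_add] at h
      exact Prod.ext hk (OffDiag.val_injective (h.trans (map_zero _).symm)),
    fun a => by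
      obtain ⟨k, b, h⟩ := S.exists_decomp ψ h2 a
      exact ⟨(k, b), h.symm⟩⟩

theorem decomp_apply (h2 : (2 : F) ≠ 0) (x : K × S.OffDiag ψ) :
    S.decomp ψ h2 x = S.ofK ψ x.1 + x.2.val := rfl

theorem d₁_eq (h2 : (2 : F) ≠ 0) (a : A) :
    S.kap ψ ((S.decomp ψ h2).symm a).1 = D.d₁ a := by
  obtain ⟨x, rfl⟩ := (S.decomp ψ h2).surjective a
  rw [AddEquiv.symm_apply_apply, decomp_apply, map_add, OffDiag.d₁_val, add_zero, d₁_ofK]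

theorem d₂_eq (h2 : (2 : F) ≠ 0) (a : A) :
    S.kap ψ (S.conj ψ ((S.decomp ψ h2).symm a).1) = D.d₂ a := by
  obtain ⟨x, rfl⟩ := (S.decomp ψ h2).surjective a
  rw [AddEquiv.symm_apply_apply, decomp_apply, map_add, OffDiag.d₂_val, add_zero, d₂_ofK]

theorem p₁_eq (h2 : (2 : F) ≠ 0) (a : A) :
    D.p₁ ((S.decomp ψ h2).symm a).2.val = D.p₁ a := by
  obtain ⟨x, rfl⟩ := (S.decomp ψ h2).surjective a
  rw [AddEquiv.symm_apply_apply, decomp_apply, map_add, p₁_ofK, zero_add]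

theorem p₂_eq (h2 : (2 : F) ≠ 0) (a : A) :
    D.p₂ ((S.decomp ψ h2).symm a).2.val = D.p₂ a := by
  obtain ⟨x, rfl⟩ := (S.decomp ψ h2).surjective a
  rw [AddEquiv.symm_apply_apply, decomp_apply, map_add, p₂_ofK, zero_add]

/-- The image of `K` is the subalgebra generated by the skew elements, since `s² = μ ≠ 0`. -/
theorem range_ofK [IsScalarTower F A A] [SMulCommClass F A A] : Set.range (S.ofK ψ) =
    (NonUnitalAlgebra.adjoin F {x : A | ι x = -x} : Set A) := by
  refine Set.Subset.antisymm ?_ ?_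
  · have hs : S.s ∈ NonUnitalAlgebra.adjoin F {x : A | ι x = -x} :=
      NonUnitalAlgebra.subset_adjoin F S.inv_s
    have h1 : (1 : A) ∈ NonUnitalAlgebra.adjoin F {x : A | ι x = -x} := by
      have h : S.μ⁻¹ • (S.s * S.s) ∈ NonUnitalAlgebra.adjoin F {x : A | ι x = -x} :=
        SMulMemClass.smul_mem _ (mul_mem hs hs)
      rwa [S.s_mul_s, inv_smul_smul₀ S.μ_ne_zero] at h
    rintro _ ⟨k, rfl⟩
    exact add_mem (SMulMemClass.smul_mem _ h1) (SMulMemClass.smul_mem _ hs)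
  · let B : NonUnitalSubalgebra F A :=
      { LinearMap.range (S.ofK ψ) with
        mul_mem' := by
          rintro _ _ ⟨k, rfl⟩ ⟨l, rfl⟩
          exact ⟨k * l, S.ofK_mul ψ k l⟩ }
    have : NonUnitalAlgebra.adjoin F {x : A | ι x = -x} ≤ B := by
      refine NonUnitalAlgebra.adjoin_le ?_
      intro x hx
      obtain ⟨r, rfl⟩ := S.eq_smul x hx
      exact ⟨ψ ⟨0, r⟩, by simp [ofK_ψ]⟩
    exact this

end Decomposition

end MatrixForm.SkewGenerator

/-! ### The algebra as a hermitian algebra -/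

namespace MatrixForm.SkewGenerator

variable {F : Type u} [Field F] {E : Type v} [Field E] [Algebra F E]
    {A : Type w} [NonAssocRing A] [Module F A] {ι : A →ₗ[F] A}
    {J₀ : Type x} [AddCommGroup J₀] [Module E J₀] {𝒥 : CubicNormStructure E J₀} {η : E}
    {D : MatrixForm ι 𝒥 η} (S : D.SkewGenerator)
    {K : Type*} [CommRing K] [Algebra F K] (ψ : QuadraticAlgebra F S.μ 0 ≃ₐ[F] K)

theorem isUnit_of_kap {k : K} (h : S.kap ψ k ≠ 0) (h' : S.kap ψ (S.conj ψ k) ≠ 0) : IsUnit k := by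
  obtain ⟨z, rfl⟩ := ψ.surjective k
  have hz : algebraMap F E z.norm = S.kap ψ (ψ z) * S.kap ψ (S.conj ψ (ψ z)) := by
    rw [kap_ψ, kap_conj_ψ, QuadraticAlgebra.norm_def]
    simp only [map_sub, map_add, map_mul, map_zero, ← S.lam_mul]
    ring
  refine IsUnit.map ψ (QuadraticAlgebra.isUnit_iff_norm_isUnit.2 (isUnit_iff_ne_zero.2 ?_))
  rintro h0
  rw [h0, map_zero] at hz
  exact mul_ne_zero h h' hz.symm

/-- Some element with zero diagonal has both off-diagonal entries of nonzero norm. If `K` is not a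
field, it is glued from two elements by means of a zero divisor of `K`. -/
theorem exists_norm_ne_zero (h2 : (2 : F) ≠ 0)
    (𝒦 : HermitianCubicNormStructure (S.conj ψ) (S.OffDiag ψ)) (hη : η ≠ 0)
    (hn₁ : ∀ b, S.kap ψ (𝒦.norm b) = η * 𝒥.norm (D.p₁ b.val))
    (hn₂ : ∀ b, S.kap ψ (S.conj ψ (𝒦.norm b)) = η ^ 2 * 𝒥.norm (D.p₂ b.val)) :
    ∃ b, IsUnit (𝒦.norm b) := by
  suffices ∃ b : S.OffDiag ψ, 𝒥.norm (D.p₁ b.val) ≠ 0 ∧ 𝒥.norm (D.p₂ b.val) ≠ 0 by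
    obtain ⟨b, h₁, h₂⟩ := this
    refine ⟨b, S.isUnit_of_kap ψ ?_ ?_⟩
    · rw [hn₁]; exact mul_ne_zero hη h₁
    · rw [hn₂]; exact mul_ne_zero (pow_ne_zero 2 hη) h₂
  obtain ⟨a₁, ha₁⟩ := D.exists_norm₁
  obtain ⟨a₂, ha₂⟩ := D.exists_norm₂
  rw [← S.p₁_eq ψ h2] at ha₁
  rw [← S.p₂_eq ψ h2] at ha₂
  generalize ((S.decomp ψ h2).symm a₁).2 = b₁ at ha₁
  generalize ((S.decomp ψ h2).symm a₂).2 = b₂ at ha₂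
  by_cases h : 𝒥.norm (D.p₂ b₁.val) = 0
  · -- the norm of `b₁` is a zero divisor `k` of `K`
    have hk₂ : S.kap ψ (S.conj ψ (𝒦.norm b₁)) = 0 := by rw [hn₂, h, mul_zero]
    have hk₁ : S.kap ψ (𝒦.norm b₁) ≠ 0 := by rw [hn₁]; exact mul_ne_zero hη ha₁
    refine ⟨𝒦.norm b₁ • b₁ + S.conj ψ (𝒦.norm b₁) • b₂, ?_, ?_⟩
    · rw [map_add, map_add, OffDiag.p₁_smul, OffDiag.p₁_smul, hk₂, zero_smul, add_zero,
        𝒥.norm_smul]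
      exact mul_ne_zero (pow_ne_zero 3 hk₁) ha₁
    · rw [map_add, map_add, OffDiag.p₂_smul, OffDiag.p₂_smul, hk₂, conj_conj, zero_smul, zero_add,
        𝒥.norm_smul]
      exact mul_ne_zero (pow_ne_zero 3 hk₁) ha₂
  · exact ⟨b₁, ha₁, h⟩

/-- The components of the product of `A` on elements with zero diagonal form a hermitian cubic norm
structure. -/
theorem exists_hermitian (h2 : (2 : F) ≠ 0) (h3 : (3 : F) ≠ 0) (hη : η ≠ 0) :
    ∃ 𝒦 : HermitianCubicNormStructure (S.conj ψ) (S.OffDiag ψ),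
      (∀ b c, 𝒦.trace b c = ((S.decomp ψ h2).symm (b.val * c.val)).1) ∧
      (∀ b c, 𝒦.cross b c = ((S.decomp ψ h2).symm (b.val * c.val)).2) ∧
      ∃ u, IsUnit (𝒦.norm u) := by
  obtain ⟨a₁, ha₁⟩ := D.exists_norm₁
  rw [← S.p₁_eq ψ h2] at ha₁
  obtain ⟨𝒦, hT, hC, hn₁, hn₂⟩ := HermitianCubicNormStructure.exists_of_split (S.conj ψ)
    (S.conj_conj ψ) 𝒥 hη h2 h3 (S.kap ψ) (S.eq_zero_of_kap ψ h2)
    (D.p₁.comp OffDiag.val) (D.p₂.comp OffDiag.val)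
    (fun b h₁ h₂ => OffDiag.ext (h₁.trans (by simp)) (h₂.trans (by simp)))
    OffDiag.p₁_smul OffDiag.p₂_smul
    (fun b c => ((S.decomp ψ h2).symm (b.val * c.val)).1)
    (fun b c => ((S.decomp ψ h2).symm (b.val * c.val)).2)
    (fun b c => by rw [d₁_eq, D.d₁_mul, OffDiag.d₁_val, zero_mul, zero_add]; rfl)
    (fun b c => by rw [d₂_eq, D.d₂_mul, OffDiag.d₂_val, zero_mul, zero_add]; rfl)
    (fun b c => by
      rw [AddMonoidHom.comp_apply, p₁_eq, D.p₁_mul, OffDiag.d₁_val, OffDiag.d₂_val, zero_smul,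
        zero_smul, zero_add, zero_add]; rfl)
    (fun b c => by
      rw [AddMonoidHom.comp_apply, p₂_eq, D.p₂_mul, OffDiag.d₁_val, OffDiag.d₂_val, zero_smul,
        zero_smul, zero_add, zero_add]; rfl)
    ⟨_, ha₁⟩
  exact ⟨𝒦, hT, hC, S.exists_norm_ne_zero ψ h2 𝒦 hη hn₁ hn₂⟩

variable [IsScalarTower F A A]

/-- The decomposition `A = K ⊕ J` as an isomorphism `𝒜(𝒦) ≅ A`. -/
noncomputable def algEquiv (h2 : (2 : F) ≠ 0)
    (𝒦 : HermitianCubicNormStructure (S.conj ψ) (S.OffDiag ψ))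
    (hT : ∀ b c, 𝒦.trace b c = ((S.decomp ψ h2).symm (b.val * c.val)).1)
    (hC : ∀ b c, 𝒦.cross b c = ((S.decomp ψ h2).symm (b.val * c.val)).2) :
    InvolutionAlgEquiv F (HermitianCubicNormStructure.Alg.involution 𝒦) ι where
  toFun x := S.decomp ψ h2 x
  invFun a := (S.decomp ψ h2).symm a
  left_inv x := (S.decomp ψ h2).symm_apply_apply x
  right_inv x := (S.decomp ψ h2).apply_symm_apply x
  map_add' x y := map_add (S.decomp ψ h2) x y
  map_smul' := by
    rintro r ⟨k, b⟩
    change S.ofK ψ (algebraMap F K r * k) + S.ofK ψ (algebraMap F K r) * b.val =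
      r • (S.ofK ψ k + b.val)
    rw [← Algebra.smul_def, map_smul, Algebra.algebraMap_eq_smul_one, map_smul, ofK_one,
      smul_one_mul, smul_add]
  map_mul := by
    rintro ⟨s, b⟩ ⟨t, c⟩
    have h : S.ofK ψ (𝒦.trace b c) + (𝒦.cross b c).val = b.val * c.val := by
      rw [hT, hC]
      exact (S.decomp ψ h2).apply_symm_apply _
    -- `b t = t^σ b` for `b` with zero diagonal
    have hbt : b.val * S.ofK ψ t = S.ofK ψ (S.conj ψ t) * b.val := by
      refine D.ext ?_ ?_ ?_ ?_ <;>
      simp [d₁_ofK, d₂_ofK, p₁_ofK, p₂_ofK, D.d₁_mul, D.d₂_mul, D.p₁_mul, D.p₂_mul,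
        𝒥.cross_zero_l, 𝒥.cross_zero_r, OffDiag.d₁_val, OffDiag.d₂_val, conj_conj]
    change S.ofK ψ (s * t + 𝒦.trace b c) + (s • c + S.conj ψ t • b + 𝒦.cross b c).val =
      (S.ofK ψ s + b.val) * (S.ofK ψ t + c.val)
    rw [map_add, map_add, map_add, OffDiag.val_smul, OffDiag.val_smul, ofK_mul, add_mul, mul_add,
      mul_add, hbt, ← h]
    abel
  map_inv := by
    rintro ⟨s, b⟩
    change S.ofK ψ (S.conj ψ s) + b.val = ι (S.ofK ψ s + b.val)
    refine D.ext ?_ ?_ ?_ ?_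
    · simp [D.d₁_inv, d₁_ofK, d₂_ofK, OffDiag.d₁_val, OffDiag.d₂_val]
    · rw [D.d₂_inv]
      simp [d₁_ofK, d₂_ofK, OffDiag.d₁_val, OffDiag.d₂_val, conj_conj]
    · rw [D.p₁_inv]; simp [p₁_ofK]
    · rw [D.p₂_inv]; simp [p₂_ofK]

theorem algEquiv_ofScalar (h2 : (2 : F) ≠ 0)
    (𝒦 : HermitianCubicNormStructure (S.conj ψ) (S.OffDiag ψ))
    (hT : ∀ b c, 𝒦.trace b c = ((S.decomp ψ h2).symm (b.val * c.val)).1)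
    (hC : ∀ b c, 𝒦.cross b c = ((S.decomp ψ h2).symm (b.val * c.val)).2) (k : K) :
    (S.algEquiv ψ h2 𝒦 hT hC).toLinearEquiv (HermitianCubicNormStructure.Alg.ofScalar 𝒦 k) =
      S.ofK ψ k := by
  change S.ofK ψ k + (0 : S.OffDiag ψ).val = S.ofK ψ k
  rw [map_zero, add_zero]

end MatrixForm.SkewGenerator

/-! ### Matrix entries from an isomorphism after scalar extension -/

/-- The norm of a cubic norm structure does not vanish on an additive group spanning it: otherwise
the trilinear form `T(a, b × c)` would vanish. -/
theorem CubicNormStructure.exists_norm_ne_zero {E : Type*} [Field E] (h2 : (2 : E) ≠ 0)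
    (h3 : (3 : E) ≠ 0) {J : Type*} [AddCommGroup J] [Module E J] (𝒥 : CubicNormStructure E J)
    {A : Type*} [AddCommGroup A] (p : A →+ J) (hp : Submodule.span E (Set.range p) = ⊤) :
    ∃ a, 𝒥.norm (p a) ≠ 0 := by
  by_contra! h
  have hneg : ∀ a, 𝒥.sharp (-a) = 𝒥.sharp a := fun a => by simpa using 𝒥.sharp_smul (-1) a
  have h₁ : ∀ a b, 𝒥.trace (p b) (𝒥.sharp (p a)) = 0 := fun a b => by
    have e₁ := 𝒥.norm_add (p a) (p b)
    have e₂ := 𝒥.norm_add (p a) (p (-b))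
    rw [← map_add, h, h, h] at e₁ e₂
    rw [map_neg p, hneg, map_neg, LinearMap.neg_apply] at e₂
    refine mul_left_cancel₀ h2 ?_
    linear_combination e₂ - e₁
  have h₂ : ∀ a b c, 𝒥.trace (p b) (𝒥.cross (p a) (p c)) = 0 := fun a b c => by
    rw [cross, QuadraticMap.polar, ← map_add, map_sub, map_sub, h₁, h₁, h₁, sub_zero, sub_zero]
  have hspan : ∀ x, x ∈ Submodule.span E (Set.range p) := fun x => hp ▸ Submodule.mem_top
  have h₃ : ∀ x y z, 𝒥.trace x (𝒥.cross y z) = 0 := by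
    intro x y z
    induction hspan x using Submodule.span_induction with
    | zero => simp
    | add x x' _ _ hx hx' => simp [hx, hx']
    | smul r x _ hx => simp [hx]
    | mem x hx =>
      obtain ⟨b, rfl⟩ := hx
      induction hspan y using Submodule.span_induction with
      | zero => simp [𝒥.cross_zero_l]
      | add x x' _ _ hx hx' => simp [hx, hx', 𝒥.cross_add_l]
      | smul r x _ hx => simp [hx, 𝒥.cross_smul_l]
      | mem y hy =>
        obtain ⟨a, rfl⟩ := hy
        induction hspan z using Submodule.span_induction with
        | zero => simp [𝒥.cross_zero_r]
        | add x x' _ _ hx hx' => simp [hx, hx', 𝒥.cross_add_r]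
        | smul r x _ hx => simp [hx, 𝒥.cross_smul_r]
        | mem z hz =>
          obtain ⟨c, rfl⟩ := hz
          exact h₂ a b c
  have h₄ := h₃ 𝒥.one 𝒥.one 𝒥.one
  rw [𝒥.cross_self, map_smul, 𝒥.trace_self_sharp h2, smul_eq_mul] at h₄
  have h₅ : 𝒥.norm 𝒥.one ≠ 0 := fun h0 => 𝒥.one_ne_zero (by
    rw [← 𝒥.sharp_one, ← 𝒥.sharp_one, 𝒥.sharp_sharp, h0, zero_smul])
  exact mul_ne_zero h2 (mul_ne_zero h3 h₅) h₄

section Tensor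

variable {F : Type u} [Field F] {E : Type v} [Field E] [Algebra F E]
  {A : Type w} [AddCommGroup A] [Module F A]

theorem one_tmul_injective {a : A} (h : (1 : E) ⊗ₜ[F] a = 0) : a = 0 := by
  refine (Module.forall_dual_apply_eq_zero_iff F a).1 fun g => ?_
  have h' := congrArg (TensorProduct.rid F E ∘ₗ g.lTensor E : E ⊗[F] A →ₗ[F] E) h
  simpa using h'

/-- Elements of `A` which are proportional over `E` are so over `F`. -/
theorem exists_eq_smul_of_one_tmul {a b : A} (ha : a ≠ 0) (c : E)
    (h : (1 : E) ⊗ₜ[F] b = c ⊗ₜ[F] a) : ∃ r : F, b = r • a := by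
  obtain ⟨g, hg⟩ : ∃ g : Module.Dual F A, g a ≠ 0 := by
    by_contra! hg
    exact ha ((Module.forall_dual_apply_eq_zero_iff F a).1 hg)
  have h' : algebraMap F E (g b) = algebraMap F E (g a) * c := by
    have h' := congrArg (TensorProduct.rid F E ∘ₗ g.lTensor E : E ⊗[F] A →ₗ[F] E) h
    simpa [Algebra.smul_def] using h'
  have hg' : algebraMap F E (g a) ≠ 0 := (map_ne_zero _).2 hg
  refine ⟨(g a)⁻¹ * g b, sub_eq_zero.1 (one_tmul_injective (F := F) (E := E) ?_)⟩
  rw [TensorProduct.tmul_sub, h, ← TensorProduct.smul_tmul, Algebra.smul_def, map_mul, h', map_inv₀,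
    inv_mul_cancel_left₀ hg', mul_one, sub_self]

theorem mem_of_one_tmul_mem (V : Submodule E (E ⊗[F] A)) (h : ∀ a, (1 : E) ⊗ₜ[F] a ∈ V)
    (x : E ⊗[F] A) : x ∈ V := by
  induction x with
  | zero => exact V.zero_mem
  | add x y hx hy => exact V.add_mem hx hy
  | tmul c a =>
    rw [← mul_one c, ← smul_eq_mul, ← TensorProduct.smul_tmul']
    exact V.smul_mem c (h a)

end Tensor

namespace MatrixForm

variable {F : Type u} [Field F] {E : Type v} [Field E] [Algebra F E]
    {A : Type w} [NonAssocRing A] [Module F A] [IsScalarTower F A A] [SMulCommClass F A A]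
    {ι : A →ₗ[F] A}
    {J₀ : Type x} [AddCommGroup J₀] [Module E J₀] {𝒥 : CubicNormStructure E J₀} {η : E}

/-- The matrix entries of the elements `1 ⊗ a`. -/
def ofEquiv (h2 : (2 : F) ≠ 0) (h3 : (3 : F) ≠ 0)
    (e : InvolutionAlgEquiv E (ι.baseChange E) (MatrixStructurable.involution 𝒥 η)) :
    MatrixForm ι 𝒥 η :=
  let e' : E ⊗[F] A ≃ₗ[E] E × J₀ × J₀ × E := e.toLinearEquiv
  let f : A →+ E × J₀ × J₀ × E :=
    e'.toAddEquiv.toAddMonoidHom.comp (TensorProduct.mk F E A 1).toAddMonoidHom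
  let p₁ : A →+ J₀ :=
    ((LinearMap.fst E J₀ (J₀ × E) ∘ₗ LinearMap.snd E E (J₀ × J₀ × E)) :).toAddMonoidHom.comp f
  let p₂ : A →+ J₀ :=
    ((LinearMap.fst E J₀ E ∘ₗ LinearMap.snd E J₀ (J₀ × E) ∘ₗ
      LinearMap.snd E E (J₀ × J₀ × E)) :).toAddMonoidHom.comp f
  have f_smul : ∀ (r : F) a, f (r • a) = algebraMap F E r • f a := fun r a => by
    change e' (1 ⊗ₜ (r • a)) = _ • e' (1 ⊗ₜ a)
    rw [← map_smul, ← TensorProduct.smul_tmul, TensorProduct.smul_tmul', Algebra.smul_def]; rfl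
  have f_ext : ∀ a, f a = 0 → a = 0 := fun a ha =>
    one_tmul_injective (F := F) (E := E) (e'.map_eq_zero_iff.1 ha)
  have f_mul : ∀ a b, f (a * b) = Mul.mul (α := MatrixStructurable 𝒥 η) (f a) (f b) := fun a b => by
    have h := e.map_mul (1 ⊗ₜ a) (1 ⊗ₜ b)
    rw [Algebra.TensorProduct.tmul_mul_tmul, one_mul] at h
    exact h
  have f_one : f 1 = (1, 0, 0, 1) := by
    have h : f 1 = One.one (α := MatrixStructurable 𝒥 η) := by
      obtain ⟨x, hx⟩ := e.toLinearEquiv.surjective 1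
      have h := e.map_mul (1 ⊗ₜ 1) x
      rw [show ((1 : E) ⊗ₜ[F] (1 : A)) = 1 from rfl, one_mul] at h
      change e.toLinearEquiv x = e.toLinearEquiv 1 * e.toLinearEquiv x at h
      rw [hx, mul_one] at h
      exact h.symm
    exact h
  have f_inv : ∀ a, f (ι a) = ((f a).2.2.2, (f a).2.1, (f a).2.2.1, (f a).1) := fun a => by
    have h := e.map_inv (1 ⊗ₜ a)
    rw [LinearMap.baseChange_tmul] at h
    exact h
  have mem : ∀ (V : Submodule E (E × J₀ × J₀ × E)), (∀ a, f a ∈ V) → ∀ y, y ∈ V :=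
    fun V hV y => by
      have h := mem_of_one_tmul_mem (V.comap e'.toLinearMap) hV (e'.symm y)
      simpa using h
  { d₁ :=
      { toFun a := (f a).1
        map_add' a b := by rw [map_add]; rfl
        map_smul' r a := by rw [f_smul, Algebra.smul_def]; rfl }
    d₂ :=
      { toFun a := (f a).2.2.2
        map_add' a b := by rw [map_add]; rfl
        map_smul' r a := by rw [f_smul, Algebra.smul_def]; rfl }
    p₁ := p₁
    p₂ := p₂
    p₁_smul := fun r a => congrArg (fun y => y.2.1) (f_smul r a)
    p₂_smul := fun r a => congrArg (fun y => y.2.2.1) (f_smul r a)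
    ext_zero := fun a h₁ h₂ h₃ h₄ => f_ext a (Prod.ext h₁ (Prod.ext h₃ (Prod.ext h₄ h₂)))
    d₁_mul := fun a b => congrArg (fun y => y.1) (f_mul a b)
    d₂_mul := fun a b => congrArg (fun y => y.2.2.2) (f_mul a b)
    p₁_mul := fun a b => congrArg (fun y => y.2.1) (f_mul a b)
    p₂_mul := fun a b => congrArg (fun y => y.2.2.1) (f_mul a b)
    d₁_one := congrArg (fun y => y.1) f_one
    d₂_one := congrArg (fun y => y.2.2.2) f_one
    p₁_one := congrArg (fun y => y.2.1) f_one
    p₂_one := congrArg (fun y => y.2.2.1) f_one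
    d₁_inv := fun a => congrArg (fun y => y.1) (f_inv a)
    d₂_inv := fun a => congrArg (fun y => y.2.2.2) (f_inv a)
    p₁_inv := fun a => congrArg (fun y => y.2.1) (f_inv a)
    p₂_inv := fun a => congrArg (fun y => y.2.2.1) (f_inv a)
    descent := fun a b c ha h₁ h₂ h₃ h₄ => by
      refine exists_eq_smul_of_one_tmul ha c (e'.injective ?_)
      rw [← mul_one c, ← smul_eq_mul, ← TensorProduct.smul_tmul', map_smul]
      exact Prod.ext h₁ (Prod.ext h₃ (Prod.ext h₄ h₂))
    exists_diag := by
      by_contra! h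
      have h' := mem (LinearMap.eqLocus (LinearMap.fst E E (J₀ × J₀ × E))
        (LinearMap.snd E J₀ E ∘ₗ LinearMap.snd E J₀ (J₀ × E) ∘ₗ LinearMap.snd E E (J₀ × J₀ × E)))
        h (1, 0, 0, 0)
      exact one_ne_zero h'
    exists_norm₁ := by
      refine 𝒥.exists_norm_ne_zero (two_ne_zero_of_algebra h2) ?_ p₁ (eq_top_iff.2 fun j _ => ?_)
      · rw [← map_ofNat (algebraMap F E) 3]
        exact (map_ne_zero _).2 h3
      · exact mem (Submodule.comap
          (LinearMap.fst E J₀ (J₀ × E) ∘ₗ LinearMap.snd E E (J₀ × J₀ × E))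
          (Submodule.span E (Set.range p₁))) (fun a => Submodule.subset_span ⟨a, rfl⟩) (0, j, 0, 0)
    exists_norm₂ := by
      refine 𝒥.exists_norm_ne_zero (two_ne_zero_of_algebra h2) ?_ p₂ (eq_top_iff.2 fun j _ => ?_)
      · rw [← map_ofNat (algebraMap F E) 3]
        exact (map_ne_zero _).2 h3
      · exact mem (Submodule.comap (LinearMap.fst E J₀ E ∘ₗ LinearMap.snd E J₀ (J₀ × E) ∘ₗ
          LinearMap.snd E E (J₀ × J₀ × E)) (Submodule.span E (Set.range p₂)))
          (fun a => Submodule.subset_span ⟨a, rfl⟩) (0, 0, j, 0) }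

end MatrixForm

/-! ### The two descriptions of a form -/

theorem mainTheorem2 {F : Type u} [Field F] (h2 : (2 : F) ≠ 0) (h3 : (3 : F) ≠ 0)
    {E : Type v} [Field E] [Algebra F E] [FiniteDimensional F E] (hE : Module.finrank F E ≤ 2)
    {A : Type w} [NonAssocRing A] [Module F A] [IsScalarTower F A A] [SMulCommClass F A A]
    (ι : A →ₗ[F] A) (hA : IsStructurable ι)
    {J₀ : Type x} [AddCommGroup J₀] [Module E J₀] (𝒥 : CubicNormStructure E J₀) (η : E) (hη : η ≠ 0)
    (hform : Nonempty
      (InvolutionAlgEquiv E (ι.baseChange E) (MatrixStructurable.involution 𝒥 η))) :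
    ∃ (K : Type w) (_ : CommRing K) (_ : Algebra F K) (σ : K ≃ₐ[F] K),
      IsQuadraticEtale F K ∧ σ ≠ AlgEquiv.refl ∧
      (∃ (J : Type w) (_ : AddCommGroup J) (_ : Module K J)
        (𝒦 : HermitianCubicNormStructure σ J)
        (e : InvolutionAlgEquiv F (HermitianCubicNormStructure.Alg.involution 𝒦) ι),
        Set.range (fun s : K => e.toLinearEquiv (HermitianCubicNormStructure.Alg.ofScalar 𝒦 s)) =
          (NonUnitalAlgebra.adjoin F {x : A | ι x = -x} : Set A)) ∧
      (∃ (J : Type w) (_ : AddCommGroup J) (_ : Module K J)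
        (P : SelfAdjointAutotopy σ J)
        (e : InvolutionAlgEquiv F (SelfAdjointAutotopy.Alg.involution P) ι),
        Set.range (fun s : K => e.toLinearEquiv (SelfAdjointAutotopy.Alg.ofScalar P s)) =
          (NonUnitalAlgebra.adjoin F {x : A | ι x = -x} : Set A)) := by
  obtain ⟨e⟩ := hform
  let D := MatrixForm.ofEquiv h2 h3 e
  obtain ⟨S⟩ := D.exists_skewGenerator h2
  have h1 : (1 : A) ≠ 0 := fun h => one_ne_zero (α := E) (by rw [← D.d₁_one, h, map_zero])
  -- `F` embeds into `A`, so that `K` can be taken in the universe of `A`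
  have : Small.{w} F := small_of_injective (smul_left_injective F h1)
  obtain ⟨K, _, _, ψ, hK⟩ := exists_isQuadraticEtale.{u, w} h2 S.μ_ne_zero
  obtain ⟨𝒦, hT, hC, u, hu⟩ := S.exists_hermitian ψ h2 h3 hη
  have h6 : IsUnit (6 : K) := by
    have h : (6 : F) ≠ 0 := by
      rw [show (6 : F) = 2 * 3 by norm_num]
      exact mul_ne_zero h2 h3
    exact map_ofNat (algebraMap F K) 6 ▸ (isUnit_iff_ne_zero.2 h).map (algebraMap F K)
  have hrange : Set.range (fun s : K => (S.algEquiv ψ h2 𝒦 hT hC).toLinearEquiv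
      (HermitianCubicNormStructure.Alg.ofScalar 𝒦 s)) =
      (NonUnitalAlgebra.adjoin F {x : A | ι x = -x} : Set A) := by
    rw [← S.range_ofK ψ]
    exact congrArg Set.range (funext fun s => S.algEquiv_ofScalar ψ h2 𝒦 hT hC s)
  refine ⟨K, _, _, S.conj ψ, hK, S.conj_ne_refl ψ h2,
    ⟨_, _, _, 𝒦, S.algEquiv ψ h2 𝒦 hT hC, hrange⟩, ?_⟩
  exact ⟨_, _, _, 𝒦.autotopy h6 (S.conj_conj ψ) hu,
    (𝒦.autotopyEquiv h6 (S.conj_conj ψ) hu).trans (S.algEquiv ψ h2 𝒦 hT hC), hrange⟩
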